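/- Let $q,z\in\mathbb C$ with $|q|<1$ and $z\neq0$. Write $(a;q)_n=\prod_{k=0}^{n-1}(1-aq^k)$, $(a;q)_\infty=\prod_{k\ge0}(1-aq^k)$, and $(a_1,\dots,a_r;q)_n=(a_1;q)_n\cdots(a_r;q)_n$ for $n\le\infty$. Define \begin{align*} S_{J1}(z,q)&=\frac{(q;q)_\infty^2}{(q^3;q^3)_\infty(z,z^{-1};q)_\infty}\sum_{n\ge1}\frac{(z,z^{-1};q)_n(q^3;q^3)_{n-1}q^n}{(q;q)_{2n-1}(q;q)_n},\\ S_{J2}(z,q)&=\frac{(q;q)_\infty^2}{(q^3;q^3)_\infty(z,z^{-1};q)_\infty}\sum_{n\ge1}\frac{(z,z^{-1};q)_n(q^3;q^3)_{n-1}q^n}{(q;q)_{2n}(q;q)_{n-1}},\\ S_{J3}(z,q)&=\frac{(q;q)_\infty^2}{(q^3;q^3)_\infty(z,z^{-1};q)_\infty}\sum_{n\ge1}\frac{(z,z^{-1};q)_n(q^3;q^3)_{n-1}q^{2n}}{(q;q)_{2n}(q;q)_{n-1}},\\ S_{F3}(z,q)&=\frac{(q;q)_\infty}{(z,z^{-1};q^2)_\infty}\sum_{n\ge1}\frac{(z,z^{-1};q^2)_nq^n}{(q;q)_{2n}},\\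 S_{G4}(z,q)&=\frac{(q^4;q^4)_\infty(-q;q^2)_\infty}{(z,z^{-1};q^2)_\infty}\sum_{n\ge1}\frac{(z,z^{-1};q^2)_n(-1)^nq^{n^2+2n}}{(q^4;q^4)_n(-q;q^2)_n},\\ S_{AG4}(z,q)&=\frac{(q^4;q^4)_\infty(-q;q^2)_\infty}{(z,z^{-1};q^2)_\infty}\sum_{n\ge1}\frac{(z,z^{-1};q^2)_n(-1)^nq^{n^2}}{(q^4;q^4)_n(-q;q^2)_n}. \end{align*} All six of these series converge. If $z$ is not of the form $q^k$ with $k\in\mathbb Z$, then \begin{align*} &(1+z)(z,z^{-1},q;q)_\infty S_{J1}(z,q)\\ &\quad=\sum_{j\ge2}\frac{(1-z^{j-1})(1-z^j)z^{1-j}(-1)^{j+1}q^{j(j-1)/2}\left(1-q^j-q^{2j-2}+q^{4j-3}+q^{5j-2}-q^{6j-3}\right)}{(1-q^{3j-3})(1-q^{3j})},\\ &(1+z)(z,z^{-1},q;q)_\infty S_{J2}(z,q)\\ &\quad=\sum_{j\ge2}\frac{(1-z^{j-1})(1-z^j)z^{1-j}(-1)^{j+1}q^{j(j-1)/2}\left(1-q^{j-1}-q^{2j}+q^{4j-1}+q^{5j-3}-q^{6j-3}\right)}{(1-q^{3j-3})(1-q^{3j})},\\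 &(1+z)(z,z^{-1},q;q)_\infty S_{J3}(z,q)\\ &\quad=\sum_{j\ge2}\frac{(1-z^{j-1})(1-z^j)z^{1-j}(-1)^{j+1}q^{j(j-1)/2}\left(q^{j-1}-q^j-q^{2j-2}+q^{2j}+q^{4j-3}-q^{4j-1}-q^{5j-3}+q^{5j-2}\right)}{(1-q^{3j-3})(1-q^{3j})}. \end{align*} If $z$ is not of the form $q^{2k}$ with $k\in\mathbb Z$, then \begin{align*} (1+z)(z,z^{-1},q;q^2)_\infty S_{F3}(z,q)&=\sum_{j=-\infty}^\infty(1-z^{j-1})(1-z^j)z^{1-j}(-1)^{j+1}q^{(j-1)^2},\\ (1+z)(z,z^{-1};q^2)_\infty S_{G4}(z,q)&=\sum_{j=-\infty}^\infty(1-z^{j-1})(1-z^j)z^{1-j}q^{2j^2-j},\\ (1+z)(z,z^{-1};q^2)_\infty S_{AG4}(z,q)&=\sum_{j=-\infty}^\infty(1-z^{j-1})(1-z^j)z^{1-j}q^{2j^2+j}. \end{align*} Moreover all six identities hold for every $z\ne0$ if, on the left-hand sides, the factor $(z,z^{-1};q)_\infty$ (respectively $(z,z^{-1};q^2)_\infty$)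 is cancelled against the same factor in the denominator of $S_X(z,q)$. All series on the right-hand sides converge absolutely. -/

import Mathlib

noncomputable section

/-- The finite product `(a; q)_n = ∏_{k=0}^{n-1} (1 - a q^k)`. -/
def qPoch (a q : ℂ) (n : ℕ) : ℂ := ∏ k ∈ Finset.range n, (1 - a * q ^ k)

/-- The infinite product `(a; q)_∞ = ∏_{k≥0} (1 - a q^k)`, used for `‖q‖ < 1`. -/
def qPochInf (a q : ℂ) : ℂ := ∏' k : ℕ, (1 - a * q ^ k)

/-- For `‖q‖ < 1` the product defining `(a; q)_∞` converges. -/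
theorem multipliable_qPochInf (a : ℂ) {q : ℂ} (hq : ‖q‖ < 1) :
    Multipliable (fun k : ℕ => 1 - a * q ^ k) := by
  have h : Summable (fun k : ℕ => ‖-(a * q ^ k)‖) := by
    simp only [norm_neg, norm_mul, norm_pow]
    exact (summable_geometric_of_lt_one (norm_nonneg q) hq).mul_left _
  simpa [sub_eq_add_neg] using multipliable_one_add_of_summable h

/-! The `n`-th summands (`n ≥ 1`) of the series that define the functions `S_X(z, q)`. -/

def sptTermJ1 (z q : ℂ) (n : ℕ) : ℂ :=
  qPoch z q n * qPoch z⁻¹ q n * qPoch (q ^ 3) (q ^ 3) (n - 1) * q ^ n /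
    (qPoch q q (2 * n - 1) * qPoch q q n)

def sptTermJ2 (z q : ℂ) (n : ℕ) : ℂ :=
  qPoch z q n * qPoch z⁻¹ q n * qPoch (q ^ 3) (q ^ 3) (n - 1) * q ^ n /
    (qPoch q q (2 * n) * qPoch q q (n - 1))

def sptTermJ3 (z q : ℂ) (n : ℕ) : ℂ :=
  qPoch z q n * qPoch z⁻¹ q n * qPoch (q ^ 3) (q ^ 3) (n - 1) * q ^ (2 * n) /
    (qPoch q q (2 * n) * qPoch q q (n - 1))

def sptTermF3 (z q : ℂ) (n : ℕ) : ℂ :=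
  qPoch z (q ^ 2) n * qPoch z⁻¹ (q ^ 2) n * q ^ n / qPoch q q (2 * n)

def sptTermG4 (z q : ℂ) (n : ℕ) : ℂ :=
  qPoch z (q ^ 2) n * qPoch z⁻¹ (q ^ 2) n * (-1) ^ n * q ^ (n ^ 2 + 2 * n) /
    (qPoch (q ^ 4) (q ^ 4) n * qPoch (-q) (q ^ 2) n)

def sptTermAG4 (z q : ℂ) (n : ℕ) : ℂ :=
  qPoch z (q ^ 2) n * qPoch z⁻¹ (q ^ 2) n * (-1) ^ n * q ^ (n ^ 2) /
    (qPoch (q ^ 4) (q ^ 4) n * qPoch (-q) (q ^ 2) n)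

/-- The product `P_X(q)` for `X = J1, J2, J3`. -/
def sptProdJ (q : ℂ) : ℂ := qPochInf q q ^ 2 / qPochInf (q ^ 3) (q ^ 3)

/-- The product `P_X(q)` for `X = F3`. -/
def sptProdF3 (q : ℂ) : ℂ := qPochInf q q

/-- The product `P_X(q)` for `X = G4, AG4`. -/
def sptProdG4 (q : ℂ) : ℂ := qPochInf (q ^ 4) (q ^ 4) * qPochInf (-q) (q ^ 2)

/-! The spt-crank-type functions `S_X(z, q)`; the sums run over the integers `n + 1 ≥ 1`. -/

def sptJ1 (z q : ℂ) : ℂ :=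
  sptProdJ q / (qPochInf z q * qPochInf z⁻¹ q) * ∑' n : ℕ, sptTermJ1 z q (n + 1)

def sptJ2 (z q : ℂ) : ℂ :=
  sptProdJ q / (qPochInf z q * qPochInf z⁻¹ q) * ∑' n : ℕ, sptTermJ2 z q (n + 1)

def sptJ3 (z q : ℂ) : ℂ :=
  sptProdJ q / (qPochInf z q * qPochInf z⁻¹ q) * ∑' n : ℕ, sptTermJ3 z q (n + 1)

def sptF3 (z q : ℂ) : ℂ :=
  sptProdF3 q / (qPochInf z (q ^ 2) * qPochInf z⁻¹ (q ^ 2)) *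
    ∑' n : ℕ, sptTermF3 z q (n + 1)

def sptG4 (z q : ℂ) : ℂ :=
  sptProdG4 q / (qPochInf z (q ^ 2) * qPochInf z⁻¹ (q ^ 2)) *
    ∑' n : ℕ, sptTermG4 z q (n + 1)

def sptAG4 (z q : ℂ) : ℂ :=
  sptProdG4 q / (qPochInf z (q ^ 2) * qPochInf z⁻¹ (q ^ 2)) *
    ∑' n : ℕ, sptTermAG4 z q (n + 1)

/-! The `j`-th terms of the single series. For `J1`, `J2`, `J3` they are used only for `j ≥ 2`,
so that no natural-number subtraction below is truncated, and `j (j - 1) / 2` is exact. -/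

def seriesTermJ1 (z q : ℂ) (j : ℕ) : ℂ :=
  (1 - z ^ (j - 1)) * (1 - z ^ j) * z ^ (1 - (j : ℤ)) * (-1) ^ (j + 1) * q ^ (j * (j - 1) / 2) *
    (1 - q ^ j - q ^ (2 * j - 2) + q ^ (4 * j - 3) + q ^ (5 * j - 2) - q ^ (6 * j - 3)) /
    ((1 - q ^ (3 * j - 3)) * (1 - q ^ (3 * j)))

def seriesTermJ2 (z q : ℂ) (j : ℕ) : ℂ :=
  (1 - z ^ (j - 1)) * (1 - z ^ j) * z ^ (1 - (j : ℤ)) * (-1) ^ (j + 1) * q ^ (j * (j - 1) / 2) *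
    (1 - q ^ (j - 1) - q ^ (2 * j) + q ^ (4 * j - 1) + q ^ (5 * j - 3) - q ^ (6 * j - 3)) /
    ((1 - q ^ (3 * j - 3)) * (1 - q ^ (3 * j)))

def seriesTermJ3 (z q : ℂ) (j : ℕ) : ℂ :=
  (1 - z ^ (j - 1)) * (1 - z ^ j) * z ^ (1 - (j : ℤ)) * (-1) ^ (j + 1) * q ^ (j * (j - 1) / 2) *
    (q ^ (j - 1) - q ^ j - q ^ (2 * j - 2) + q ^ (2 * j) + q ^ (4 * j - 3) - q ^ (4 * j - 1)
      - q ^ (5 * j - 3) + q ^ (5 * j - 2)) /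
    ((1 - q ^ (3 * j - 3)) * (1 - q ^ (3 * j)))

def seriesTermF3 (z q : ℂ) (j : ℤ) : ℂ :=
  (1 - z ^ (j - 1)) * (1 - z ^ j) * z ^ (1 - j) * (-1) ^ (j + 1) * q ^ ((j - 1) ^ 2)

def seriesTermG4 (z q : ℂ) (j : ℤ) : ℂ :=
  (1 - z ^ (j - 1)) * (1 - z ^ j) * z ^ (1 - j) * q ^ (2 * j ^ 2 - j)

def seriesTermAG4 (z q : ℂ) (j : ℤ) : ℂ :=
  (1 - z ^ (j - 1)) * (1 - z ^ j) * z ^ (1 - j) * q ^ (2 * j ^ 2 + j)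

end

open Filter Topology

/-! ### Finite and infinite `q`-products -/

/-! The method is that of conjugate Bailey pairs. With base Q = q (J1, J2, J3) or Q = q² (F3, G4,
AG4), the defining series are brought to the form ∑ δ_n (z, z⁻¹; Q)_n / (Q; Q)_{2n}, directly in all
cases except J1.

The polynomial (1 + z)(z, z⁻¹; Q)_n / (Q; Q)_{2n} has an explicit expansion in z^(r+1) + z^(-r), a
finite form of the Jacobi triple product (`sum_symCoeff_mul`). For n ≥ 1 it vanishes at z = 1, so
its coefficients sum to zero and each monomial may be replaced by z^(r+1) + z^(-r) - 1 - z, the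
factor seen on the right-hand sides (`sum_symCoeff_mul_symFactor`). Interchanging the sums
(`hasSum_symSeries`) leaves, for each r ≥ 1, the single sum ∑_m δ_{m+r} / ((Q)_m (Q)_{m+2r+1}).

These inner sums come from the `q`-Gauss sum (`tsum_gaussTerm`, `hasSum_conj`), because δ_{m+r} /
δ_r is a product of two shifted factorials. For J2 and J3 this uses 1 - t³ = (1 - t)(1 - wt)(1 -
w²t) with w a primitive cube root of unity; for G4 and AG4 one parameter has gone to infinity. For
F3, G4 and J3 the Gauss balancing condition matches the denominator (Q)_{m+2r+1}. For J2 and AG4 it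
matches (Q)_{m+2r}, and `one_sub_mul_conjSum` combines two such sums. J1 is the termwise sum of J2
and J3. The bilateral series for F3, G4 and AG4 are folded by pairing j = r + 1 with j = -r. -/

theorem qPoch_zero (a q : ℂ) : qPoch a q 0 = 1 := by simp [qPoch]

theorem qPoch_succ (a q : ℂ) (n : ℕ) : qPoch a q (n + 1) = qPoch a q n * (1 - a * q ^ n) := by
  simp [qPoch, Finset.prod_range_succ]

theorem qPoch_add (a q : ℂ) (m n : ℕ) :
    qPoch a q (m + n) = qPoch a q m * qPoch (a * q ^ m) q n := by
  simp only [qPoch, Finset.prod_range_add]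
  congr 1
  exact Finset.prod_congr rfl fun k _ => by ring

theorem qPoch_succ' (a q : ℂ) (n : ℕ) :
    qPoch a q (n + 1) = (1 - a) * qPoch (a * q) q n := by
  rw [add_comm, qPoch_add]
  simp [qPoch]

theorem qPochInf_eq_mul (a : ℂ) {q : ℂ} (hq : ‖q‖ < 1) (n : ℕ) :
    qPochInf a q = qPoch a q n * qPochInf (a * q ^ n) q := by
  have h := multipliable_qPochInf (a * q ^ n) hq
  have e : (fun k : ℕ => 1 - a * q ^ n * q ^ k) = fun k => 1 - a * q ^ (k + n) := by
    funext k
    rw [pow_add, mul_assoc, mul_comm (q ^ n)]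
  have h1 : qPochInf (a * q ^ n) q = ∏' k : ℕ, (1 - a * q ^ (k + n)) := congrArg tprod e
  rw [e] at h
  rw [h1]
  exact (Multipliable.prod_mul_tprod_nat_mul' (f := fun k : ℕ => 1 - a * q ^ k) h).symm

theorem tendsto_qPoch (a : ℂ) {q : ℂ} (hq : ‖q‖ < 1) :
    Tendsto (fun n => qPoch a q n) atTop (𝓝 (qPochInf a q)) :=
  (multipliable_qPochInf a hq).tendsto_prod_tprod_nat

theorem qPoch_ne_zero {a q : ℂ} (h : ∀ k : ℕ, a * q ^ k ≠ 1) (n : ℕ) : qPoch a q n ≠ 0 :=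
  Finset.prod_ne_zero_iff.2 fun k _ => sub_ne_zero.2 (h k).symm

theorem qPochInf_ne_zero {a q : ℂ} (hq : ‖q‖ < 1) (h : ∀ k : ℕ, a * q ^ k ≠ 1) :
    qPochInf a q ≠ 0 := by
  have hs : Summable (fun k : ℕ => ‖-(a * q ^ k)‖) := by
    simp only [norm_neg, norm_mul, norm_pow]
    exact (summable_geometric_of_lt_one (norm_nonneg q) hq).mul_left _
  have := tprod_one_add_ne_zero_of_summable (f := fun k : ℕ => -(a * q ^ k))
    (fun k => by rw [← sub_eq_add_neg]; exact sub_ne_zero.2 (h k).symm) hs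
  simpa [qPochInf, sub_eq_add_neg] using this

theorem mul_pow_ne_one {a q : ℂ} (hq : ‖q‖ < 1) (ha : ‖a‖ < 1) (k : ℕ) : a * q ^ k ≠ 1 := by
  intro h
  have h1 : ‖a * q ^ k‖ = 1 := by rw [h, norm_one]
  rw [norm_mul, norm_pow] at h1
  have h2 : ‖q‖ ^ k ≤ 1 := pow_le_one₀ (norm_nonneg _) hq.le
  nlinarith [norm_nonneg a, norm_nonneg q]

theorem norm_pow_lt_one {q : ℂ} (hq : ‖q‖ < 1) {k : ℕ} (hk : k ≠ 0) : ‖q ^ k‖ < 1 := by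
  rw [norm_pow]; exact pow_lt_one₀ (norm_nonneg _) hq hk

theorem one_sub_pow_ne_zero {q : ℂ} (hq : ‖q‖ < 1) {k : ℕ} (hk : k ≠ 0) : 1 - q ^ k ≠ 0 := by
  intro h
  have h1 := norm_pow_lt_one hq hk
  rw [← sub_eq_zero.1 h, norm_one] at h1
  exact lt_irrefl _ h1

theorem qPoch_ne_zero_of_norm_lt {a q : ℂ} (hq : ‖q‖ < 1) (ha : ‖a‖ < 1) (n : ℕ) :
    qPoch a q n ≠ 0 := qPoch_ne_zero (mul_pow_ne_one hq ha) n

theorem qPochInf_ne_zero_of_norm_lt {a q : ℂ} (hq : ‖q‖ < 1) (ha : ‖a‖ < 1) :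
    qPochInf a q ≠ 0 := qPochInf_ne_zero hq (mul_pow_ne_one hq ha)

theorem exists_norm_le_of_tendsto {u : ℕ → ℂ} {l : ℂ} (h : Tendsto u atTop (𝓝 l)) :
    ∃ C : ℝ, 0 < C ∧ ∀ n, ‖u n‖ ≤ C := by
  obtain ⟨C, hC⟩ := (Metric.isBounded_range_of_tendsto u h).exists_norm_le
  exact ⟨max C 1, by positivity, fun n => (hC _ ⟨n, rfl⟩).trans (le_max_left _ _)⟩

theorem exists_norm_qPoch_le (a : ℂ) {q : ℂ} (hq : ‖q‖ < 1) :
    ∃ C : ℝ, 0 < C ∧ ∀ n, ‖qPoch a q n‖ ≤ C :=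
  exists_norm_le_of_tendsto (tendsto_qPoch a hq)

theorem exists_norm_inv_qPoch_le {a q : ℂ} (hq : ‖q‖ < 1) (h : ∀ k : ℕ, a * q ^ k ≠ 1) :
    ∃ C : ℝ, 0 < C ∧ ∀ n, ‖(qPoch a q n)⁻¹‖ ≤ C :=
  exists_norm_le_of_tendsto ((tendsto_qPoch a hq).inv₀ (qPochInf_ne_zero hq h))

theorem tendsto_mul_pow_nhds_zero (a : ℂ) {q : ℂ} (hq : ‖q‖ < 1) :
    Tendsto (fun n : ℕ => a * q ^ n) atTop (𝓝 0) := by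
  simpa using (tendsto_pow_atTop_nhds_zero_of_norm_lt_one hq).const_mul a

/-! ### The `q`-Gauss sum in homogeneous form -/

/-- The product `∏_{k<n} (x - y q^k)`. -/
noncomputable def qPochHom (x y q : ℂ) (n : ℕ) : ℂ := ∏ k ∈ Finset.range n, (x - y * q ^ k)

theorem qPochHom_succ (x y q : ℂ) (n : ℕ) :
    qPochHom x y q (n + 1) = qPochHom x y q n * (x - y * q ^ n) := by
  simp [qPochHom, Finset.prod_range_succ]

/-- Homogeneity stands in for the power (c/(ab))^n of the classical sum, so no division by x occurs
and x = 0 is allowed. -/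
theorem qPochHom_scale (x y q c : ℂ) (n : ℕ) :
    qPochHom (x * c) (y * c) q n = c ^ n * qPochHom x y q n := by
  induction n with
  | zero => simp [qPochHom]
  | succ n ih => rw [qPochHom_succ, qPochHom_succ, ih]; ring

/-- The summand of the `q`-Gauss sum; `x = c / (a b)` and `y = c / a` in the classical notation. -/
noncomputable def gaussTerm (a x y q : ℂ) (n : ℕ) : ℂ :=
  qPoch a q n * qPochHom x y q n / (qPoch q q n * qPoch (a * y) q n)

theorem summable_of_ratio {f ρ : ℕ → ℂ} {l : ℂ} (hl : ‖l‖ < 1) (hρ : Tendsto ρ atTop (𝓝 l))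
    (h : ∀ n, f (n + 1) = f n * ρ n) : Summable f := by
  obtain ⟨r, hr, hr1⟩ := exists_between hl
  refine summable_of_ratio_norm_eventually_le hr1 ?_
  filter_upwards [hρ.norm.eventually_lt_const hr] with n hn
  rw [h, norm_mul, mul_comm]
  exact mul_le_mul_of_nonneg_right hn.le (norm_nonneg _)

theorem gaussTerm_succ {a x y q : ℂ} (n : ℕ) :
    gaussTerm a x y q (n + 1) = gaussTerm a x y q n *
      ((1 - a * q ^ n) * (x - y * q ^ n) / ((1 - q * q ^ n) * (1 - a * y * q ^ n))) := by
  simp only [gaussTerm, qPoch_succ, qPochHom_succ]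
  rw [div_mul_div_comm]
  congr 1 <;> ring

theorem summable_gaussTerm (a y : ℂ) {x q : ℂ} (hq : ‖q‖ < 1) (hx : ‖x‖ < 1) :
    Summable (gaussTerm a x y q) := by
  refine summable_of_ratio (l := x) hx ?_ fun n => gaussTerm_succ n
  have h := fun b => tendsto_mul_pow_nhds_zero b hq
  have := (((h a).const_sub 1).mul ((h y).const_sub x)).div
    (((h q).const_sub 1).mul ((h (a * y)).const_sub 1)) (by simp)
  simpa [Pi.div_def] using this

/-- Contiguous relation for the shift (x, y) → (xq, yq), with its telescoping certificate. The
factor 1 - q^n makes the boundary term at n = 0 vanish. -/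
theorem gaussTerm_telescope {a x y q : ℂ} (hq : ‖q‖ < 1) (h : ∀ k : ℕ, a * y * q ^ k ≠ 1) (n : ℕ) :
    (1 - a * y) * (1 - x) * gaussTerm a x y q n -
        (1 - a * x) * (1 - y) * gaussTerm a (x * q) (y * q) q n =
      (1 - a * y) * ((1 - q ^ n) * gaussTerm a x y q n) -
        (1 - a * y) * ((1 - q ^ (n + 1)) * gaussTerm a x y q (n + 1)) := by
  have h1 : qPoch q q n ≠ 0 := qPoch_ne_zero_of_norm_lt hq hq n
  have h2 : qPoch (a * y) q n ≠ 0 := qPoch_ne_zero h n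
  have h3 : 1 - a * y * q ^ n ≠ 0 := sub_ne_zero.2 (h n).symm
  have h4 : 1 - q ^ (n + 1) ≠ 0 := one_sub_pow_ne_zero hq n.succ_ne_zero
  have h4' : 1 - q ^ n * q ≠ 0 := by rwa [← pow_succ]
  have h0 : 1 - a * y ≠ 0 := by simpa using sub_ne_zero.2 (h 0).symm
  have h6 : qPoch (a * y * q) q n = qPoch (a * y) q n * (1 - a * y * q ^ n) / (1 - a * y) := by
    rw [eq_div_iff h0, ← qPoch_succ, qPoch_succ', mul_comm]
  rw [gaussTerm_succ]
  simp only [gaussTerm, qPochHom_scale, ← mul_assoc a y q, h6, pow_succ, mul_comm q]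
  generalize q ^ n = Q at *
  field_simp
  ring

theorem tsum_gaussTerm_step {a x y q : ℂ} (hq : ‖q‖ < 1) (hx : ‖x‖ < 1)
    (h : ∀ k : ℕ, a * y * q ^ k ≠ 1) :
    (1 - a * y) * (1 - x) * ∑' n, gaussTerm a x y q n =
      (1 - a * x) * (1 - y) * ∑' n, gaussTerm a (x * q) (y * q) q n := by
  have hxq : ‖x * q‖ < 1 := by
    rw [norm_mul]; nlinarith [norm_nonneg x, norm_nonneg q]
  have s1 := summable_gaussTerm a y hq hx
  have s2 := summable_gaussTerm a (y * q) hq hxq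
  have hG : Tendsto (fun n => (1 - a * y) * ((1 - q ^ n) * gaussTerm a x y q n)) atTop (𝓝 0) := by
    have := (((tendsto_pow_atTop_nhds_zero_of_norm_lt_one hq).const_sub 1).mul
      s1.tendsto_atTop_zero).const_mul (1 - a * y)
    simpa using this
  have hs := (s1.hasSum.mul_left ((1 - a * y) * (1 - x))).sub
    (s2.hasSum.mul_left ((1 - a * x) * (1 - y)))
  have h1 := hs.tendsto_sum_nat
  simp only [gaussTerm_telescope hq h] at h1
  have e : ∀ N, ∑ n ∈ Finset.range N, ((1 - a * y) * ((1 - q ^ n) * gaussTerm a x y q n) -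
        (1 - a * y) * ((1 - q ^ (n + 1)) * gaussTerm a x y q (n + 1))) =
        0 - (1 - a * y) * ((1 - q ^ N) * gaussTerm a x y q N) := by
    intro N
    rw [Finset.sum_range_sub' (fun n => (1 - a * y) * ((1 - q ^ n) * gaussTerm a x y q n))]
    simp
  simp only [e] at h1
  have h2 := tendsto_nhds_unique h1 (hG.const_sub 0)
  rw [sub_zero] at h2
  exact sub_eq_zero.1 h2

theorem norm_mul_pow_lt_one {x q : ℂ} (hq : ‖q‖ < 1) (hx : ‖x‖ < 1) (N : ℕ) :
    ‖x * q ^ N‖ < 1 := by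
  rw [norm_mul, norm_pow]
  exact (mul_le_of_le_one_right (norm_nonneg _) (pow_le_one₀ (norm_nonneg _) hq.le)).trans_lt hx

theorem tsum_gaussTerm_iterate {a x y q : ℂ} (hq : ‖q‖ < 1) (hx : ‖x‖ < 1)
    (h : ∀ k : ℕ, a * y * q ^ k ≠ 1) (N : ℕ) :
    qPoch (a * y) q N * qPoch x q N * ∑' n, gaussTerm a x y q n =
      qPoch (a * x) q N * qPoch y q N * ∑' n, gaussTerm a (x * q ^ N) (y * q ^ N) q n := by
  induction N with
  | zero => simp [qPoch_zero]
  | succ N ih =>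
    have := tsum_gaussTerm_step (a := a) (x := x * q ^ N) (y := y * q ^ N) hq
      (norm_mul_pow_lt_one hq hx N) (fun k => by
        have := h (N + k)
        rwa [pow_add, ← mul_assoc, mul_assoc a] at this)
    simp only [qPoch_succ]
    rw [show x * q ^ (N + 1) = x * q ^ N * q by ring, show y * q ^ (N + 1) = y * q ^ N * q by ring]
    linear_combination (1 - a * y * q ^ N) * (1 - x * q ^ N) * ih +
      qPoch (a * x) q N * qPoch y q N * this

/-- After N shifts the n-th term carries the factor q^(nN), so only n = 0 survives in the limit;
dominated convergence justifies this. -/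
theorem tendsto_tsum_gaussTerm {a x y q : ℂ} (hq : ‖q‖ < 1) (hx : ‖x‖ < 1)
    (h : ∀ k : ℕ, a * y * q ^ k ≠ 1) :
    Tendsto (fun N : ℕ => ∑' n, gaussTerm a (x * q ^ N) (y * q ^ N) q n) atTop (𝓝 1) := by
  obtain ⟨C, hC0, hC⟩ := exists_norm_inv_qPoch_le hq h
  obtain ⟨D, hD0, hD⟩ := exists_norm_qPoch_le (a * y) hq
  -- Uses (ayq^N; q)_n = (ay; q)_{N+n} / (ay; q)_N, which reduces the shifted denominators to
  -- products bounded uniformly in N and n.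
  have key : ∀ N n, gaussTerm a (x * q ^ N) (y * q ^ N) q n =
      (q ^ n) ^ N * (gaussTerm a x y q n *
        (qPoch (a * y) q n * qPoch (a * y) q N * (qPoch (a * y) q (N + n))⁻¹)) := by
    intro N n
    have h1 := qPoch_ne_zero h n
    have h2 := qPoch_ne_zero h N
    have h3 := qPoch_ne_zero h (N + n)
    rw [qPoch_add] at h3 ⊢
    have h4 := right_ne_zero_of_mul h3
    have h5 := qPoch_ne_zero_of_norm_lt hq hq n
    simp only [gaussTerm, qPochHom_scale, ← mul_assoc a y]
    rw [pow_right_comm]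
    field_simp
  have hsum : Summable fun n => ‖gaussTerm a x y q n‖ * (D * D * C) :=
    (summable_gaussTerm a y hq hx).norm.mul_right _
  have hB : ∀ N n, ‖gaussTerm a x y q n *
      (qPoch (a * y) q n * qPoch (a * y) q N * (qPoch (a * y) q (N + n))⁻¹)‖ ≤
      ‖gaussTerm a x y q n‖ * (D * D * C) := by
    intro N n
    rw [norm_mul, norm_mul, norm_mul]
    gcongr
    exacts [hD n, hD N, hC _]
  have h1 : Tendsto (fun N : ℕ => ∑' n, gaussTerm a (x * q ^ N) (y * q ^ N) q n) atTop
      (𝓝 (∑' n : ℕ, if n = 0 then 1 else 0)) := by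
    refine tendsto_tsum_of_dominated_convergence hsum ?_ ?_
    · intro n
      rcases Nat.eq_zero_or_pos n with rfl | hn
      · simp [gaussTerm, qPoch_zero, qPochHom]
      · rw [if_neg hn.ne']
        simp only [key]
        refine (tendsto_pow_atTop_nhds_zero_of_norm_lt_one
          (norm_pow_lt_one hq hn.ne')).zero_mul_isBoundedUnder_le ?_
        exact isBoundedUnder_of ⟨_, fun N => hB N n⟩
    · refine Eventually.of_forall fun N n => ?_
      rw [key, norm_mul]
      refine (mul_le_of_le_one_left (norm_nonneg _) ?_).trans (hB N n)
      rw [← pow_mul, norm_pow]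
      exact pow_le_one₀ (norm_nonneg _) hq.le
  simpa using h1

/-- The `q`-Gauss sum; the case `x = 0` is its limit `b → ∞`. -/
theorem tsum_gaussTerm {a x y q : ℂ} (hq : ‖q‖ < 1) (hx : ‖x‖ < 1)
    (h : ∀ k : ℕ, a * y * q ^ k ≠ 1) :
    qPochInf (a * y) q * qPochInf x q * ∑' n, gaussTerm a x y q n =
      qPochInf (a * x) q * qPochInf y q := by
  have h1 := ((tendsto_qPoch (a * y) hq).mul (tendsto_qPoch x hq)).mul_const
    (∑' n, gaussTerm a x y q n)
  simp only [tsum_gaussTerm_iterate hq hx h] at h1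
  have h2 := ((tendsto_qPoch (a * x) hq).mul (tendsto_qPoch y hq)).mul
    (tendsto_tsum_gaussTerm hq hx h)
  rw [mul_one] at h2
  exact tendsto_nhds_unique h1 h2

/-! ### Expansion of `(1 + z) (z, z⁻¹; q)_n` in powers of `z` -/

/-- The coefficient of `z^(r+1) + z^(-r)` in `(1 + z) (z, z⁻¹; q)_n / (q; q)_{2n}`. -/
noncomputable def symCoeff (q : ℂ) (n r : ℕ) : ℂ :=
  if r ≤ n then
    (-1) ^ r * q ^ (r.choose 2) * (1 - q ^ (2 * r + 1)) /
      (qPoch q q (n - r) * qPoch q q (n + r + 1))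
  else 0

theorem symCoeff_of_lt {q : ℂ} {n r : ℕ} (h : n < r) : symCoeff q n r = 0 := by
  rw [symCoeff, if_neg (by omega)]

/-- Setting n = m + r removes both the case distinction and the truncated subtraction. -/
theorem symCoeff_add (q : ℂ) (m r : ℕ) :
    symCoeff q (m + r) r = (-1) ^ r * q ^ (r.choose 2) * (1 - q ^ (2 * r + 1)) /
      (qPoch q q m * qPoch q q (m + 2 * r + 1)) := by
  rw [symCoeff, if_pos (by omega), Nat.add_sub_cancel, show m + r + r + 1 = m + 2 * r + 1 by ring]

theorem choose_two_succ (r : ℕ) : (r + 1).choose 2 = r.choose 2 + r := by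
  rw [Nat.choose_succ_succ' r 1, Nat.choose_one_right, add_comm]

theorem qPoch_self_ne_zero {q : ℂ} (hq : ‖q‖ < 1) (k : ℕ) : qPoch q q k ≠ 0 :=
  qPoch_ne_zero_of_norm_lt hq hq k

/-- The factor 1 - q^k lets one formula cover the boundary k = 0, where the coefficient lies outside
its range and vanishes. -/
theorem symCoeff_succ_right {q : ℂ} (hq : ‖q‖ < 1) (k r : ℕ) :
    symCoeff q (k + r) (r + 1) =
      (-1) ^ (r + 1) * q ^ ((r + 1).choose 2) * (1 - q ^ (2 * r + 3)) * (1 - q ^ k) /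
        (qPoch q q k * qPoch q q (k + 2 * r + 2)) := by
  rcases k with _ | k
  · rw [symCoeff_of_lt (by omega)]; simp
  · have h0 := qPoch_self_ne_zero hq k
    have h1 := qPoch_self_ne_zero hq (k + 2 * r + 3)
    have h2 := one_sub_pow_ne_zero hq k.succ_ne_zero
    rw [show k + 1 + r = k + (r + 1) by ring, symCoeff_add,
      show k + 2 * (r + 1) + 1 = k + 2 * r + 3 by ring, show 2 * (r + 1) + 1 = 2 * r + 3 by ring,
      show k + 1 + 2 * r + 2 = k + 2 * r + 3 by ring, qPoch_succ q q k, ← pow_succ']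
    field_simp

/-- The coefficient at 0 occurs also in the neighbour term because the monomial of index -1, namely
1 + z, equals the one of index 0. -/
theorem symCoeff_rec_zero {q : ℂ} (hq : ‖q‖ < 1) (n : ℕ) :
    (1 - q ^ (2 * n + 1)) * (1 - q ^ (2 * n + 2)) * symCoeff q (n + 1) 0 =
      (1 + q ^ (2 * n)) * symCoeff q n 0 - q ^ n * (symCoeff q n 0 + symCoeff q n 1) := by
  have e0 := symCoeff_add q n 0
  have e1 := symCoeff_add q (n + 1) 0
  have e2 := symCoeff_succ_right hq n 0
  have h0 := qPoch_self_ne_zero hq n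
  have h1 := one_sub_pow_ne_zero hq n.succ_ne_zero
  have h2 := one_sub_pow_ne_zero hq (n + 1).succ_ne_zero
  simp only [mul_zero, add_zero, zero_add, Nat.choose_zero_succ, qPoch_succ, pow_zero, pow_one,
    Nat.choose_succ_self] at e0 e1 e2
  rw [e0, e1, e2]
  rw [show q ^ (2 * n + 1) = (q ^ n) ^ 2 * q by ring,
    show q ^ (2 * n + 2) = (q ^ n) ^ 2 * q ^ 2 by ring, show q ^ (2 * n) = (q ^ n) ^ 2 by ring,
    show q * q ^ (n + 1) = q ^ n * q ^ 2 by ring, show q * q ^ n = q ^ n * q by ring]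
  rw [show q ^ (n.succ) = q ^ n * q from pow_succ _ _] at h1
  rw [show q ^ ((n + 1).succ) = q ^ n * q ^ 2 by rw [Nat.succ_eq_add_one]; ring] at h2
  generalize q ^ n = X at *
  field_simp
  ring

/-- Coefficient form of multiplication by (1 - zq^n)(1 - z⁻¹q^n) = 1 + q^(2n) - q^n (z + z⁻¹), since
z + z⁻¹ shifts the index of the monomials by ±1. -/
theorem symCoeff_rec_succ {q : ℂ} (hq : ‖q‖ < 1) {n r : ℕ} (hr : r ≤ n) :
    (1 - q ^ (2 * n + 1)) * (1 - q ^ (2 * n + 2)) * symCoeff q (n + 1) (r + 1) =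
      (1 + q ^ (2 * n)) * symCoeff q n (r + 1) -
        q ^ n * (symCoeff q n r + symCoeff q n (r + 2)) := by
  obtain ⟨m, rfl⟩ := Nat.exists_eq_add_of_le' hr
  rcases m with _ | k
  · have e1 := symCoeff_add q 0 r
    have e2 := symCoeff_add q 0 (r + 1)
    have h0 := qPoch_self_ne_zero hq (2 * r + 1)
    have h1 := one_sub_pow_ne_zero hq (2 * r + 1).succ_ne_zero
    have h2 := one_sub_pow_ne_zero hq (2 * r + 2).succ_ne_zero
    rw [choose_two_succ, show 0 + 2 * (r + 1) + 1 = 2 * r + 1 + 1 + 1 by ring, qPoch_succ,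
      qPoch_succ, show 2 * (r + 1) + 1 = 2 * r + 3 by ring] at e2
    simp only [zero_add, qPoch_zero] at e1 e2 ⊢
    rw [symCoeff_of_lt (r := r + 1) r.lt_succ_self, symCoeff_of_lt (r := r + 2) (by omega), e1, e2]
    simp only [Nat.succ_eq_add_one, add_assoc, Nat.reduceAdd, pow_add, ← mul_assoc, pow_one] at *
    simp only [show q * q ^ (2 * r) * q = q ^ (2 * r) * q ^ 2 by ring,
      show q * q ^ (2 * r) * q ^ 2 = q ^ (2 * r) * q ^ 3 by ring] at *
    generalize qPoch q q _ = P at *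
    rw [show q ^ (2 * r) = (q ^ r) ^ 2 by ring] at *
    generalize q ^ r = X at *
    field_simp
    ring
  · have e0 := symCoeff_add q (k + 1) r
    have e1 := symCoeff_add q k (r + 1)
    have e2 := symCoeff_add q (k + 1) (r + 1)
    have e3 := symCoeff_succ_right hq k (r + 1)
    have hk := qPoch_self_ne_zero hq k
    have hP := qPoch_self_ne_zero hq (k + 2 * r + 2)
    have h1 := one_sub_pow_ne_zero hq k.succ_ne_zero
    have h2 := one_sub_pow_ne_zero hq (k + 2 * r + 2).succ_ne_zero
    have h3 := one_sub_pow_ne_zero hq (k + 2 * r + 3).succ_ne_zero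
    rw [show k + 1 + 2 * r + 1 = k + 2 * r + 2 by ring, qPoch_succ] at e0
    rw [show k + 2 * (r + 1) + 1 = k + 2 * r + 2 + 1 by ring, qPoch_succ q q (k + 2 * r + 2),
      show k + (r + 1) = k + 1 + r by ring, choose_two_succ] at e1
    rw [show k + 1 + 2 * (r + 1) + 1 = k + 2 * r + 2 + 1 + 1 by ring,
      qPoch_succ q q (k + 2 * r + 2 + 1), qPoch_succ q q (k + 2 * r + 2),
      show k + 1 + (r + 1) = k + 1 + r + 1 by ring, choose_two_succ, qPoch_succ] at e2
    rw [show k + 2 * (r + 1) + 2 = k + 2 * r + 2 + 1 + 1 by ring,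
      qPoch_succ q q (k + 2 * r + 2 + 1), qPoch_succ q q (k + 2 * r + 2),
      show k + (r + 1) = k + 1 + r by ring, choose_two_succ, choose_two_succ] at e3
    rw [e0, e1, e2, e3]
    clear e0 e1 e2 e3
    generalize qPoch q q (k + 2 * r + 2) = P at *
    generalize qPoch q q k = R at *
    rw [show q ^ k.succ = q ^ k * q from pow_succ _ _] at h1
    rw [show q ^ (k + 2 * r + 2).succ = (q ^ r) ^ 2 * q ^ k * q ^ 3 by
      rw [Nat.succ_eq_add_one]; ring] at h2
    rw [show q ^ (k + 2 * r + 3).succ = (q ^ r) ^ 2 * q ^ k * q ^ 4 by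
      rw [Nat.succ_eq_add_one]; ring] at h3
    simp only [show q * q ^ (k + 2 * r + 2) = (q ^ r) ^ 2 * q ^ k * q ^ 3 by ring,
      show q * q ^ (k + 2 * r + 2 + 1) = (q ^ r) ^ 2 * q ^ k * q ^ 4 by ring,
      show q * q ^ k = q ^ k * q by ring,
      show q ^ (2 * (k + 1 + r) + 1) = (q ^ r) ^ 2 * (q ^ k) ^ 2 * q ^ 3 by ring,
      show q ^ (2 * (k + 1 + r) + 2) = (q ^ r) ^ 2 * (q ^ k) ^ 2 * q ^ 4 by ring,
      show q ^ (2 * (k + 1 + r)) = (q ^ r) ^ 2 * (q ^ k) ^ 2 * q ^ 2 by ring,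
      show q ^ (k + 1 + r) = q ^ r * q ^ k * q by ring,
      show q ^ (2 * r + 1) = (q ^ r) ^ 2 * q by ring,
      show q ^ (2 * (r + 1) + 1) = (q ^ r) ^ 2 * q ^ 3 by ring,
      show q ^ (2 * (r + 1) + 3) = (q ^ r) ^ 2 * q ^ 5 by ring]
    simp only [pow_add, pow_one]
    generalize q ^ (r.choose 2) = T at *
    generalize q ^ k = Y at *
    generalize q ^ r = X at *
    field_simp
    ring

/-! `symMonomial z r` is `z^(r+1) + z^(-r)`. -/

noncomputable def symMonomial (z : ℂ) (r : ℕ) : ℂ := z ^ (r + 1) + z⁻¹ ^ r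

theorem symMonomial_rec_zero {z : ℂ} (hz : z ≠ 0) :
    (z + z⁻¹) * symMonomial z 0 = symMonomial z 1 + symMonomial z 0 := by
  simp only [symMonomial]; field_simp; ring

theorem symMonomial_rec_succ {z : ℂ} (hz : z ≠ 0) (r : ℕ) :
    (z + z⁻¹) * symMonomial z (r + 1) = symMonomial z (r + 2) + symMonomial z r := by
  simp only [symMonomial, inv_pow]; field_simp; ring

/-- Moves multiplication by z + z⁻¹ from the monomials to the coefficients. The last two terms are
boundary terms, zero once e vanishes from index M on. -/
theorem sum_mul_symMonomial {z : ℂ} (hz : z ≠ 0) (e : ℕ → ℂ) (M : ℕ) :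
    ∑ r ∈ Finset.range (M + 1), e r * ((z + z⁻¹) * symMonomial z r) =
      (e 0 + e 1) * symMonomial z 0 +
        ∑ r ∈ Finset.range M, (e r + e (r + 2)) * symMonomial z (r + 1) +
        e M * symMonomial z (M + 1) - e (M + 1) * symMonomial z M := by
  induction M with
  | zero => simp [symMonomial_rec_zero hz]; ring
  | succ M ih =>
    rw [Finset.sum_range_succ, ih, Finset.sum_range_succ, symMonomial_rec_succ hz]
    ring

theorem sum_symCoeff_mul {q z : ℂ} (hq : ‖q‖ < 1) (hz : z ≠ 0) (n : ℕ) :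
    ∑ r ∈ Finset.range (n + 1), symCoeff q n r * symMonomial z r =
      (1 + z) * (qPoch z q n * qPoch z⁻¹ q n / qPoch q q (2 * n)) := by
  induction n with
  | zero =>
    have h := one_sub_pow_ne_zero hq one_ne_zero
    rw [pow_one] at h
    simp [symCoeff, symMonomial, qPoch, h]; ring
  | succ n ih =>
    have h1 := one_sub_pow_ne_zero hq (2 * n).succ_ne_zero
    have h2 := one_sub_pow_ne_zero hq (2 * n + 1).succ_ne_zero
    have h0 := qPoch_self_ne_zero hq (2 * n)
    simp only [Nat.succ_eq_add_one] at h1 h2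
    apply mul_left_cancel₀ (mul_ne_zero h1 h2)
    have hp := sum_mul_symMonomial hz (symCoeff q n) (n + 1)
    rw [symCoeff_of_lt (r := n + 1) (by omega), symCoeff_of_lt (r := n + 1 + 1) (by omega),
      Finset.sum_range_succ, symCoeff_of_lt (r := n + 1) (by omega)] at hp
    have ih1 : ∑ r ∈ Finset.range (n + 1), symCoeff q n (r + 1) * symMonomial z (r + 1) =
        (1 + z) * (qPoch z q n * qPoch z⁻¹ q n / qPoch q q (2 * n)) -
          symCoeff q n 0 * symMonomial z 0 := by
      rw [← ih, eq_sub_iff_add_eq,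
        ← Finset.sum_range_succ' (fun r => symCoeff q n r * symMonomial z r), Finset.sum_range_succ, symCoeff_of_lt (r := n + 1) (by omega)]
      simp
    have hp1 : ∑ r ∈ Finset.range (n + 1), symCoeff q n r * ((z + z⁻¹) * symMonomial z r) =
        (z + z⁻¹) * ((1 + z) * (qPoch z q n * qPoch z⁻¹ q n / qPoch q q (2 * n))) := by
      rw [← ih, Finset.mul_sum]
      exact Finset.sum_congr rfl fun r _ => by ring
    rw [hp1] at hp
    rw [Finset.sum_range_succ', mul_add, Finset.mul_sum]
    have hs : ∀ r ∈ Finset.range (n + 1), (1 - q ^ (2 * n + 1)) * (1 - q ^ (2 * n + 1 + 1)) *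
        (symCoeff q (n + 1) (r + 1) * symMonomial z (r + 1)) =
        (1 + q ^ (2 * n)) * (symCoeff q n (r + 1) * symMonomial z (r + 1)) -
        q ^ n * ((symCoeff q n r + symCoeff q n (r + 2)) * symMonomial z (r + 1)) := by
      intro r hr
      rw [← mul_assoc, symCoeff_rec_succ hq (Nat.lt_succ_iff.1 (Finset.mem_range.1 hr))]
      ring
    rw [Finset.sum_congr rfl hs, Finset.sum_sub_distrib, ← Finset.mul_sum, ← Finset.mul_sum, ih1,
      ← mul_assoc _ (symCoeff q (n + 1) 0), symCoeff_rec_zero hq]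
    have hp2 : ∑ r ∈ Finset.range (n + 1),
        (symCoeff q n r + symCoeff q n (r + 2)) * symMonomial z (r + 1) =
        (z + z⁻¹) * ((1 + z) * (qPoch z q n * qPoch z⁻¹ q n / qPoch q q (2 * n))) -
        (symCoeff q n 0 + symCoeff q n 1) * symMonomial z 0 := by
      linear_combination -hp
    rw [hp2, show 2 * (n + 1) = 2 * n + 1 + 1 by ring]
    simp only [qPoch_succ, ← pow_succ']
    have h3 : (1 - z * q ^ n) * (1 - z⁻¹ * q ^ n) =
        1 + q ^ (2 * n) - q ^ n * (z + z⁻¹) := by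
      field_simp; ring
    have h4 : (1 + z) * (qPoch z q n * (1 - z * q ^ n) * (qPoch z⁻¹ q n * (1 - z⁻¹ * q ^ n)) /
        (qPoch q q (2 * n) * (1 - q ^ (2 * n + 1)) * (1 - q ^ (2 * n + 1 + 1)))) =
        (1 + z) * (qPoch z q n * qPoch z⁻¹ q n / qPoch q q (2 * n)) *
        ((1 - z * q ^ n) * (1 - z⁻¹ * q ^ n)) /
          ((1 - q ^ (2 * n + 1)) * (1 - q ^ (2 * n + 1 + 1))) := by
      field_simp
    rw [h4, h3, mul_div_cancel₀ _ (mul_ne_zero h1 h2)]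
    ring

/-- The function `z^(r+1) + z^(-r) - 1 - z = (1 - z^r) (1 - z^(r+1)) z^(-r)`. -/
noncomputable def symFactor (z : ℂ) (r : ℕ) : ℂ := z ^ (r + 1) + z⁻¹ ^ r - 1 - z

/-- At z = 1 the product (1; q)_n is zero for n ≥ 1, so the coefficients sum to zero and 1 + z can
be subtracted from every monomial. -/
theorem sum_symCoeff_mul_symFactor {q z : ℂ} (hq : ‖q‖ < 1) (hz : z ≠ 0) {n : ℕ} (hn : n ≠ 0) :
    ∑ r ∈ Finset.range (n + 1), symCoeff q n r * symFactor z r =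
      (1 + z) * (qPoch z q n * qPoch z⁻¹ q n / qPoch q q (2 * n)) := by
  have h1 := sum_symCoeff_mul (z := 1) hq one_ne_zero n
  obtain ⟨m, rfl⟩ := Nat.exists_eq_succ_of_ne_zero hn
  rw [Nat.succ_eq_add_one, ← sum_symCoeff_mul hq hz]
  simp only [Nat.succ_eq_add_one, symMonomial, qPoch_succ' 1, sub_self, zero_mul, zero_div, mul_zero,
    one_pow, inv_one, ← Finset.sum_mul] at h1
  have h2 : ∑ r ∈ Finset.range (m + 1 + 1), symCoeff q (m + 1) r = 0 := by
    linear_combination h1 / 2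
  calc _ = ∑ r ∈ Finset.range (m + 1 + 1), (symCoeff q (m + 1) r * symMonomial z r -
        symCoeff q (m + 1) r * (1 + z)) :=
        Finset.sum_congr rfl fun r _ => by simp only [symFactor, symMonomial]; ring
    _ = _ := by rw [Finset.sum_sub_distrib, ← Finset.sum_mul, h2, zero_mul, sub_zero]

/-! ### Interchange of summations -/

theorem HasSum.congr_both {ι : Type*} {f g : ι → ℂ} {a b : ℂ} (h : HasSum f a)
    (hfg : ∀ n, g n = f n) (hab : b = a) : HasSum g b := by
  rw [hab, funext hfg]; exact h

theorem summable_pow_choose_mul_pow {q : ℂ} (hq : ‖q‖ < 1) (w : ℂ) :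
    Summable fun r : ℕ => q ^ (r.choose 2) * w ^ r := by
  refine summable_of_ratio (l := 0) (ρ := fun r => w * q ^ r) (by simp)
    (tendsto_mul_pow_nhds_zero w hq) fun r => ?_
  rw [choose_two_succ]; ring

/-- The bound is uniform in n, and its quadratic exponent in r beats the geometric growth of
`symFactor`; this makes the double series absolutely convergent. -/
theorem exists_norm_symCoeff_le {q : ℂ} (hq : ‖q‖ < 1) :
    ∃ K : ℝ, 0 < K ∧ ∀ n r, ‖symCoeff q n r‖ ≤ K * ‖q‖ ^ (r.choose 2) := by
  obtain ⟨C, hC0, hC⟩ := exists_norm_inv_qPoch_le hq (mul_pow_ne_one hq hq)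
  refine ⟨2 * (C * C), by positivity, fun n r => ?_⟩
  rw [symCoeff]
  split_ifs with h
  · rw [div_eq_mul_inv, mul_inv, norm_mul, norm_mul, norm_mul, norm_mul, norm_pow, norm_neg,
      norm_one, one_pow, one_mul, norm_pow]
    have h1 : ‖1 - q ^ (2 * r + 1)‖ ≤ 2 := by
      refine (norm_sub_le _ _).trans ?_
      have := (norm_pow_lt_one hq (2 * r).succ_ne_zero).le
      rw [norm_one]; linarith
    calc _ ≤ ‖q‖ ^ r.choose 2 * 2 * (C * C) := by gcongr <;> apply hC
      _ = _ := by ring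
  · rw [norm_zero]; positivity

theorem symFactor_zero (z : ℂ) : symFactor z 0 = 0 := by simp [symFactor]

theorem exists_norm_symFactor_le (z : ℂ) :
    ∃ B : ℝ, 0 < B ∧ ∀ r, ‖symFactor z r‖ ≤ 4 * B * B ^ r := by
  refine ⟨1 + ‖z‖ + ‖z⁻¹‖, by positivity, fun r => ?_⟩
  set B := 1 + ‖z‖ + ‖z⁻¹‖ with hB
  have h1 : (1 : ℝ) ≤ B := by rw [hB]; linarith [norm_nonneg z, norm_nonneg z⁻¹]
  have h2 : ‖z‖ ≤ B := by rw [hB]; linarith [norm_nonneg z⁻¹]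
  have h3 : ‖z⁻¹‖ ≤ B := by rw [hB]; linarith [norm_nonneg z]
  have h4 : B ^ r ≤ B ^ (r + 1) := pow_le_pow_right₀ h1 r.le_succ
  have h5 : B ≤ B ^ (r + 1) := le_self_pow₀ h1 r.succ_ne_zero
  have a1 : ‖z ^ (r + 1)‖ ≤ B ^ (r + 1) := by rw [norm_pow]; gcongr
  have a2 : ‖z⁻¹ ^ r‖ ≤ B ^ r := by rw [norm_pow]; gcongr
  have h6 : 4 * B * B ^ r = 4 * B ^ (r + 1) := by ring
  rw [symFactor, h6]
  calc _ ≤ ‖z ^ (r + 1)‖ + ‖z⁻¹ ^ r‖ + ‖(1 : ℂ)‖ + ‖z‖ :=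
        (norm_sub_le _ _).trans (add_le_add_left ((norm_sub_le _ _).trans
          (add_le_add_left (norm_add_le _ _) _)) _)
    _ ≤ _ := by rw [norm_one]; linarith

/-- A conjugate Bailey pair relative to `a = q`, up to normalisation. -/
noncomputable def conjSum (q : ℂ) (δ : ℕ → ℂ) (r : ℕ) : ℂ :=
  ∑' m, δ (m + r) / (qPoch q q m * qPoch q q (m + 2 * r + 1))

theorem summable_symSeries {q z : ℂ} (hq : ‖q‖ < 1) {δ : ℕ → ℂ} {C ρ : ℝ} (hρ0 : 0 ≤ ρ)
    (hρ : ρ < 1) (hδ : ∀ n, ‖δ (n + 1)‖ ≤ C * ρ ^ n) :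
    Summable fun n => δ (n + 1) *
      (qPoch z q (n + 1) * qPoch z⁻¹ q (n + 1) / qPoch q q (2 * (n + 1))) := by
  obtain ⟨C1, h1, hC1⟩ := exists_norm_qPoch_le z hq
  obtain ⟨C2, h2, hC2⟩ := exists_norm_qPoch_le z⁻¹ hq
  obtain ⟨C3, h3, hC3⟩ := exists_norm_inv_qPoch_le hq (mul_pow_ne_one hq hq)
  refine Summable.of_norm_bounded (g := fun n => C * ρ ^ n * (C1 * C2 * C3))
    (((summable_geometric_of_lt_one hρ0 hρ).mul_left C).mul_right _) fun n => ?_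
  rw [norm_mul, div_eq_mul_inv, norm_mul, norm_mul]
  have := (norm_nonneg _).trans (hδ n)
  gcongr
  exacts [hδ n, hC1 _, hC2 _, hC3 _]

theorem hasSum_symSeries {q z : ℂ} (hq : ‖q‖ < 1) (hz : z ≠ 0) {δ : ℕ → ℂ} {C ρ : ℝ}
    (hρ0 : 0 ≤ ρ) (hρ : ρ < 1) (hδ : ∀ n, ‖δ (n + 1)‖ ≤ C * ρ ^ n) :
    HasSum (fun r : ℕ => symFactor z (r + 1) * ((-1) ^ (r + 1) * q ^ ((r + 1).choose 2) *
        ((1 - q ^ (2 * (r + 1) + 1)) * conjSum q δ (r + 1))))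
      ((1 + z) * ∑' n, δ (n + 1) *
        (qPoch z q (n + 1) * qPoch z⁻¹ q (n + 1) / qPoch q q (2 * (n + 1)))) := by
  obtain ⟨K, hK0, hK⟩ := exists_norm_symCoeff_le hq
  obtain ⟨B, hB0, hB⟩ := exists_norm_symFactor_le z
  have hC : 0 ≤ C := by simpa using (norm_nonneg _).trans (hδ 0)
  let F : ℕ × ℕ → ℂ := fun p => δ (p.1 + 1) * (symCoeff q (p.1 + 1) p.2 * symFactor z p.2)
  have hs : Summable F := by
    have s1 : Summable fun n : ℕ => C * ρ ^ n :=
      (summable_geometric_of_lt_one hρ0 hρ).mul_left C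
    have s2 : Summable fun r : ℕ => K * (4 * B) * (‖q‖ ^ (r.choose 2) * B ^ r) := by
      have := (summable_pow_choose_mul_pow hq (B : ℂ)).norm
      simp only [norm_mul, norm_pow, Complex.norm_real, Real.norm_eq_abs, abs_of_pos hB0] at this
      exact this.mul_left _
    refine Summable.of_norm_bounded (s1.mul_of_nonneg s2 (fun n => by positivity)
      fun r => by positivity) fun p => ?_
    simp only [F, norm_mul]
    calc _ ≤ C * ρ ^ p.1 * (K * ‖q‖ ^ (p.2.choose 2) * (4 * B * B ^ p.2)) := by
          gcongr
          exacts [hδ _, hK _ _, hB _]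
      _ = _ := by ring
  have hrow : ∀ n, HasSum (fun r => F (n, r)) ((1 + z) * (δ (n + 1) *
      (qPoch z q (n + 1) * qPoch z⁻¹ q (n + 1) / qPoch q q (2 * (n + 1))))) := by
    intro n
    have : HasSum (fun r => F (n, r)) (∑ r ∈ Finset.range (n + 1 + 1), F (n, r)) :=
      hasSum_sum_of_ne_finset_zero fun r hr => by
        simp only [F]
        rw [symCoeff_of_lt (by simpa using hr)]
        simp
    refine this.congr_both (fun _ => rfl) ?_
    simp only [F]
    rw [← Finset.mul_sum, sum_symCoeff_mul_symFactor hq hz n.succ_ne_zero]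
    ring
  have h1 : HasSum _ (∑' p, F p) := hs.hasSum.prod_fiberwise hrow
  have hs' := hs.prod_symm
  have h2 : HasSum (fun r => ∑' n, F (n, r)) (∑' p : ℕ × ℕ, F p.swap) :=
    hs'.hasSum.prod_fiberwise (fun r => (hs'.prod_factor r).hasSum)
  have e1 : ∑' p, F p = (1 + z) * ∑' n, δ (n + 1) *
      (qPoch z q (n + 1) * qPoch z⁻¹ q (n + 1) / qPoch q q (2 * (n + 1))) := by
    rw [← tsum_mul_left]; exact h1.tsum_eq.symm
  have e2 : ∑' p : ℕ × ℕ, F p.swap = ∑' p, F p := (Equiv.prodComm ℕ ℕ).tsum_eq F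
  rw [e2, e1] at h2
  have h3 := (hasSum_nat_add_iff' 1).2 h2
  have e3 : ∑' n, F (n, 0) = 0 := by simp [F, symFactor_zero]
  rw [Finset.sum_range_one, e3, sub_zero] at h3
  have e4 : ∀ r, ∑' n, F (n, r + 1) = symFactor z (r + 1) * ((-1) ^ (r + 1) *
      q ^ ((r + 1).choose 2) * ((1 - q ^ (2 * (r + 1) + 1)) * conjSum q δ (r + 1))) := by
    intro r
    have hr : Summable fun n => F (n, r + 1) := hs'.prod_factor (r + 1)
    -- The terms with n < r vanish, as `symCoeff` is then out of range; the substitution n = m + r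
    -- turns the rest into `conjSum` at r + 1.
    rw [← hr.sum_add_tsum_nat_add r, Finset.sum_eq_zero, zero_add, conjSum, ← tsum_mul_left,
      ← tsum_mul_left, ← tsum_mul_left]
    · refine tsum_congr fun m => ?_
      simp only [F]
      rw [add_assoc m r 1, symCoeff_add]
      ring
    · intro n hn
      simp only [F]
      rw [symCoeff_of_lt (by simpa using hn)]
      simp
  simpa only [e4] using h3

/-- Conversion from the parameter `a = 1` to the parameter `a = q`. -/
theorem one_sub_mul_conjSum {q : ℂ} (hq : ‖q‖ < 1) {δ : ℕ → ℂ} {r : ℕ} {A B : ℂ}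
    (hA : HasSum (fun m => δ (m + r) / (qPoch q q m * qPoch q q (m + 2 * r))) A)
    (hB : HasSum (fun m => δ (m + (r + 1)) / (qPoch q q m * qPoch q q (m + 2 * (r + 1)))) B) :
    (1 - q ^ (2 * r + 1)) * conjSum q δ r = A - q ^ (2 * r + 1) * B := by
  -- The identity behind the conversion is 1 - q^(2r+1) = (1 - q^(m+2r+1)) - q^(2r+1) (1 - q^m). The
  -- second part vanishes at m = 0 and, shifted by one, is the series of B.
  have hB' : HasSum (fun m => δ (m + r) * (1 - q ^ m) /
      (qPoch q q m * qPoch q q (m + 2 * r + 1))) B := by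
    have h := hasSum_nat_add_iff (f := fun m => δ (m + r) * (1 - q ^ m) /
      (qPoch q q m * qPoch q q (m + 2 * r + 1))) (g := B) 1
    rw [Finset.sum_range_one, pow_zero, sub_self, mul_zero, zero_div, add_zero] at h
    refine h.1 (hB.congr_both (fun m => ?_) rfl)
    have n1 := qPoch_self_ne_zero hq m
    have n2 := one_sub_pow_ne_zero hq m.succ_ne_zero
    have n3 := qPoch_self_ne_zero hq (m + 2 * (r + 1))
    rw [show m + 1 + 2 * r + 1 = m + 2 * (r + 1) by ring, qPoch_succ, ← pow_succ',
      show m + 1 + r = m + (r + 1) by ring]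
    rw [Nat.succ_eq_add_one] at n2
    field_simp
  rw [← (hA.sub (hB'.mul_left (q ^ (2 * r + 1)))).tsum_eq, conjSum, ← tsum_mul_left]
  refine tsum_congr fun m => ?_
  have n1 := qPoch_self_ne_zero hq m
  have n2 := qPoch_self_ne_zero hq (m + 2 * r)
  have n3 := one_sub_pow_ne_zero hq (m + 2 * r).succ_ne_zero
  rw [Nat.succ_eq_add_one] at n3
  rw [qPoch_succ, ← pow_succ']
  field_simp
  ring

theorem qPochInf_self_ne_zero {q : ℂ} (hq : ‖q‖ < 1) : qPochInf q q ≠ 0 :=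
  qPochInf_ne_zero_of_norm_lt hq hq

/-- The `q`-Gauss sum as a statement about conjugate Bailey pairs. -/
theorem hasSum_conj {q a x y d : ℂ} (hq : ‖q‖ < 1) (hx : ‖x‖ < 1) {δ : ℕ → ℂ} {r s : ℕ}
    (hδ : ∀ m, δ (m + r) = d * (qPoch a q m * qPochHom x y q m)) (hs : a * y = q ^ (s + 1)) :
    HasSum (fun m => δ (m + r) / (qPoch q q m * qPoch q q (m + s)))
      (d * (qPochInf (a * x) q * qPochInf y q) / (qPochInf q q * qPochInf x q)) := by
  have h1 : ∀ k : ℕ, a * y * q ^ k ≠ 1 := by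
    rw [hs]; exact mul_pow_ne_one hq (norm_pow_lt_one hq s.succ_ne_zero)
  have h2 := (summable_gaussTerm a y hq hx).hasSum.mul_left (d / qPoch q q s)
  have h3 := tsum_gaussTerm hq hx h1
  -- The denominator (q; q)_{m+s} splits as (q; q)_s (q^(s+1); q)_m, and q^(s+1) = ay is the lower
  -- parameter of the Gauss sum.
  have h4 := qPochInf_eq_mul q hq s
  rw [← pow_succ', ← hs] at h4
  have n1 := qPoch_self_ne_zero hq s
  have n2 : qPochInf (a * y) q ≠ 0 := qPochInf_ne_zero hq h1
  have n3 : qPochInf x q ≠ 0 := qPochInf_ne_zero_of_norm_lt hq hx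
  refine h2.congr_both (fun m => ?_) ?_
  · rw [hδ, gaussTerm, add_comm m s, qPoch_add, ← pow_succ', ← hs]
    have n4 := qPoch_ne_zero h1 m
    have n5 := qPoch_self_ne_zero hq m
    field_simp
  · rw [h4, ← h3]
    field_simp

theorem conjSum_eq {q a x y d : ℂ} (hq : ‖q‖ < 1) (hx : ‖x‖ < 1) {δ : ℕ → ℂ} {r : ℕ}
    (hδ : ∀ m, δ (m + r) = d * (qPoch a q m * qPochHom x y q m))
    (hs : a * y = q ^ (2 * r + 1 + 1)) :
    conjSum q δ r =
      d * (qPochInf (a * x) q * qPochInf y q) / (qPochInf q q * qPochInf x q) :=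
  (hasSum_conj (s := 2 * r + 1) hq hx hδ hs).tsum_eq

/-! ### Bilateral series -/

theorem summable_symFactor_mul {q : ℂ} (hq : ‖q‖ < 1) (z : ℂ) {c : ℕ → ℂ}
    (hc : ∀ r, ‖c r‖ ≤ ‖q‖ ^ (r.choose 2)) : Summable fun r => symFactor z r * c r := by
  obtain ⟨B, hB0, hB⟩ := exists_norm_symFactor_le z
  have := (summable_pow_choose_mul_pow hq (B : ℂ)).norm
  simp only [norm_mul, norm_pow, Complex.norm_real, Real.norm_eq_abs, abs_of_pos hB0] at this
  refine Summable.of_norm_bounded (this.mul_left (4 * B)) fun r => ?_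
  rw [norm_mul]
  calc _ ≤ 4 * B * B ^ r * ‖q‖ ^ (r.choose 2) := by
        gcongr
        exacts [hB r, hc r]
    _ = _ := by ring

/-- The indices j = r + 1 and j = -r share the factor `symFactor z r`. The bounds on c₁ and c₂ make
each half summable by itself, which the combined sum alone would not give. -/
theorem hasSum_int_of_symFactor {q z : ℂ} (hq : ‖q‖ < 1) {f : ℤ → ℂ} {c₁ c₂ : ℕ → ℂ} {S : ℂ}
    (h₁ : ∀ r : ℕ, f (r + 1) = symFactor z r * c₁ r)
    (h₂ : ∀ r : ℕ, f (-r) = symFactor z r * c₂ r)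
    (hc₁ : ∀ r, ‖c₁ r‖ ≤ ‖q‖ ^ (r.choose 2)) (hc₂ : ∀ r, ‖c₂ r‖ ≤ ‖q‖ ^ (r.choose 2))
    (h : HasSum (fun r : ℕ => symFactor z (r + 1) * (c₁ (r + 1) + c₂ (r + 1))) S) :
    HasSum f S := by
  have s1 := (summable_symFactor_mul hq z hc₁).hasSum
  have s2 := (summable_symFactor_mul hq z hc₂).hasSum
  have s3 := s1.add s2
  have h' := (hasSum_nat_add_iff (f := fun r => symFactor z r * (c₁ r + c₂ r)) 1).1 h
  rw [Finset.sum_range_one, symFactor_zero, zero_mul, add_zero] at h'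
  simp only [← mul_add] at s3
  have e := s3.unique h'
  rw [← e, ← (Equiv.addRight (1 : ℤ)).hasSum_iff]
  refine HasSum.of_nat_of_neg_add_one ?_ ?_
  · simpa only [Function.comp_apply, Equiv.coe_addRight, h₁] using s1
  · have : ∀ n : ℕ, -((n : ℤ) + 1) + 1 = -n := fun n => by ring
    simpa only [Function.comp_apply, Equiv.coe_addRight, this, h₂] using s2

/-! ### Product dissections -/

theorem qPoch_two_mul (b q : ℂ) (n : ℕ) :
    qPoch b q (2 * n) = qPoch b (q ^ 2) n * qPoch (b * q) (q ^ 2) n := by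
  induction n with
  | zero => simp [qPoch_zero]
  | succ n ih =>
    rw [show 2 * (n + 1) = 2 * n + 1 + 1 by ring, qPoch_succ, qPoch_succ, ih, qPoch_succ,
      qPoch_succ]
    ring

theorem qPochInf_eq_mul_sq (b : ℂ) {q : ℂ} (hq : ‖q‖ < 1) :
    qPochInf b q = qPochInf b (q ^ 2) * qPochInf (b * q) (q ^ 2) := by
  have hq2 := norm_pow_lt_one hq two_ne_zero
  have h1 : Tendsto (fun n : ℕ => qPoch b q (2 * n)) atTop (𝓝 (qPochInf b q)) :=
    (tendsto_qPoch b hq).comp (tendsto_id.const_mul_atTop' (r := 2) two_pos)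
  refine tendsto_nhds_unique h1 ?_
  simpa only [← qPoch_two_mul] using (tendsto_qPoch b hq2).mul (tendsto_qPoch (b * q) hq2)

theorem qPoch_sq (a q : ℂ) (n : ℕ) :
    qPoch (a ^ 2) (q ^ 2) n = qPoch a q n * qPoch (-a) q n := by
  simp only [qPoch, ← Finset.prod_mul_distrib]
  exact Finset.prod_congr rfl fun k _ => by ring

theorem qPochInf_sq (a : ℂ) {q : ℂ} (hq : ‖q‖ < 1) :
    qPochInf (a ^ 2) (q ^ 2) = qPochInf a q * qPochInf (-a) q := by
  refine tendsto_nhds_unique (tendsto_qPoch (a ^ 2) (norm_pow_lt_one hq two_ne_zero)) ?_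
  simpa only [← qPoch_sq] using (tendsto_qPoch a hq).mul (tendsto_qPoch (-a) hq)

/-- Factorwise, 1 - t³ = (1 - t)(1 - wt)(1 - w²t) with t = aq^k. -/
theorem qPoch_cube {w : ℂ} (hw : w ^ 2 + w + 1 = 0) (a q : ℂ) (n : ℕ) :
    qPoch (a ^ 3) (q ^ 3) n = qPoch a q n * (qPoch (w * a) q n * qPoch (w ^ 2 * a) q n) := by
  simp only [qPoch, ← Finset.prod_mul_distrib]
  refine Finset.prod_congr rfl fun k _ => ?_
  have h3 : w ^ 3 = 1 := by linear_combination (w - 1) * hw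
  have e : (q ^ 3) ^ k = (q ^ k) ^ 3 := pow_right_comm _ _ _
  rw [e]
  generalize q ^ k = X
  linear_combination ((a * X) ^ 3 - (a * X) ^ 2) * h3 + (a * X - (a * X) ^ 2) * hw

theorem qPochInf_cube {w : ℂ} (hw : w ^ 2 + w + 1 = 0) (a : ℂ) {q : ℂ} (hq : ‖q‖ < 1) :
    qPochInf (a ^ 3) (q ^ 3) =
      qPochInf a q * (qPochInf (w * a) q * qPochInf (w ^ 2 * a) q) := by
  refine tendsto_nhds_unique (tendsto_qPoch (a ^ 3) (norm_pow_lt_one hq three_ne_zero)) ?_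
  exact ((tendsto_qPoch a hq).mul ((tendsto_qPoch (w * a) hq).mul
    (tendsto_qPoch (w ^ 2 * a) hq))).congr fun n => (qPoch_cube hw a q n).symm

theorem exists_cube_root : ∃ w : ℂ, w ^ 2 + w + 1 = 0 := by
  obtain ⟨s, hs⟩ := IsAlgClosed.exists_pow_nat_eq (-3 : ℂ) two_pos
  exact ⟨(s - 1) / 2, by linear_combination hs / 4⟩

/-! ### Closed forms of `qPochHom` at the parameters that occur -/

theorem qPochHom_one (y q : ℂ) (n : ℕ) : qPochHom 1 y q n = qPoch y q n := rfl

theorem qPochHom_self_mul (y q c : ℂ) (n : ℕ) :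
    qPochHom c (y * c) q n = c ^ n * qPoch y q n := by
  have := qPochHom_scale 1 y q c n
  rwa [one_mul, qPochHom_one] at this

theorem two_mul_choose_two_add (r : ℕ) : 2 * r.choose 2 + r = r ^ 2 := by
  induction r with
  | zero => rfl
  | succ r ih => rw [choose_two_succ]; linarith

theorem qPochHom_zero_sq (q : ℂ) (s m : ℕ) :
    qPochHom 0 (q ^ (s + 1)) (q ^ 2) m = (-1) ^ m * q ^ (m ^ 2 + s * m) := by
  induction m with
  | zero => simp [qPochHom]
  | succ m ih => rw [qPochHom_succ, ih]; ring

theorem qPochInf_zero (q : ℂ) : qPochInf 0 q = 1 := by simp [qPochInf]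

/-! ### The factors `(1 - z^(j-1)) (1 - z^j) z^(1-j)` -/

theorem symFactor_nat {z : ℂ} (hz : z ≠ 0) (r : ℕ) :
    (1 - z ^ r) * (1 - z ^ (r + 1)) * z⁻¹ ^ r = symFactor z r := by
  rw [symFactor, inv_pow]
  field_simp
  ring

theorem symFactor_int_pos {z : ℂ} (hz : z ≠ 0) (r : ℕ) :
    (1 - z ^ ((r : ℤ) + 1 - 1)) * (1 - z ^ ((r : ℤ) + 1)) * z ^ (1 - ((r : ℤ) + 1)) =
      symFactor z r := by
  rw [← symFactor_nat hz, add_sub_cancel_right, show 1 - ((r : ℤ) + 1) = -r by ring, zpow_neg,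
    ← inv_zpow, zpow_natCast, zpow_natCast, ← Nat.cast_succ, zpow_natCast]

theorem symFactor_int_neg {z : ℂ} (hz : z ≠ 0) (r : ℕ) :
    (1 - z ^ (-(r : ℤ) - 1)) * (1 - z ^ (-(r : ℤ))) * z ^ (1 - (-(r : ℤ))) = symFactor z r := by
  rw [show -(r : ℤ) - 1 = -((r + 1 : ℕ) : ℤ) by push_cast; ring,
    show 1 - (-(r : ℤ)) = ((r + 1 : ℕ) : ℤ) by push_cast; ring, symFactor, zpow_neg, zpow_neg,
    zpow_natCast, zpow_natCast, inv_pow]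
  field_simp
  ring

theorem norm_mul_pow_le_of_le {q : ℂ} (hq : ‖q‖ < 1) {u : ℂ} (hu : ‖u‖ = 1) {k e : ℕ}
    (h : k ≤ e) : ‖u * q ^ e‖ ≤ ‖q‖ ^ k := by
  rw [norm_mul, hu, one_mul, norm_pow]
  exact pow_le_pow_of_le_one (norm_nonneg _) hq.le h

theorem norm_pow_le_of_le {q : ℂ} (hq : ‖q‖ < 1) {n e : ℕ} (h : n ≤ e) : ‖q ^ e‖ ≤ ‖q‖ ^ n := by
  rw [norm_pow]
  exact pow_le_pow_of_le_one (norm_nonneg _) hq.le h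

/-! ### The function `S_{F3}` -/

noncomputable def weightF3 (q : ℂ) (n : ℕ) : ℂ := qPoch (-q) q (2 * n) * q ^ n

theorem exists_norm_weightF3_le {q : ℂ} (hq : ‖q‖ < 1) :
    ∃ C : ℝ, ∀ n, ‖weightF3 q (n + 1)‖ ≤ C * ‖q‖ ^ n := by
  obtain ⟨C, hC0, hC⟩ := exists_norm_qPoch_le (-q) hq
  refine ⟨C, fun n => ?_⟩
  rw [weightF3, norm_mul]
  gcongr
  exacts [hC _, norm_pow_le_of_le hq n.le_succ]

theorem sptTermF3_eq {q : ℂ} (hq : ‖q‖ < 1) (z : ℂ) (n : ℕ) :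
    sptTermF3 z q n = weightF3 q n *
      (qPoch z (q ^ 2) n * qPoch z⁻¹ (q ^ 2) n / qPoch (q ^ 2) (q ^ 2) (2 * n)) := by
  have h1 := qPoch_self_ne_zero hq (2 * n)
  have h2 : qPoch (-q) q (2 * n) ≠ 0 := qPoch_ne_zero_of_norm_lt hq (by rwa [norm_neg]) _
  rw [sptTermF3, weightF3, qPoch_sq]
  field_simp

theorem one_add_pow_ne_zero {q : ℂ} (hq : ‖q‖ < 1) {k : ℕ} (hk : k ≠ 0) : 1 + q ^ k ≠ 0 := by
  intro h
  have h1 := norm_pow_lt_one hq hk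
  rw [eq_neg_of_add_eq_zero_right h, norm_neg, norm_one] at h1
  exact lt_irrefl _ h1

/-- Splitting (-q^(2r+1); q)_{2m} into even and odd factors gives a Gauss sum in base q² with upper
parameters -q^(2r+1), -q^(2r+2) and argument q. -/
theorem conjSum_weightF3 {q : ℂ} (hq : ‖q‖ < 1) (r : ℕ) :
    qPochInf q (q ^ 2) * sptProdF3 q * ((1 - (q ^ 2) ^ (2 * r + 1)) *
      conjSum (q ^ 2) (weightF3 q) r) = q ^ r * (1 - q ^ (2 * r + 1)) := by
  have hq2 := norm_pow_lt_one hq two_ne_zero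
  have h := conjSum_eq (q := q ^ 2) (a := -q * q ^ (2 * r)) (x := q)
    (y := -q * q ^ (2 * r) * q * q) (d := qPoch (-q) q (2 * r) * q ^ r) (δ := weightF3 q)
    (r := r) hq2 hq (fun m => by
      rw [qPochHom_self_mul, weightF3, add_comm m r, mul_add, qPoch_add,
        qPoch_two_mul (-q * q ^ (2 * r))]
      ring) (by ring)
  rw [h]
  have e1 : qPochInf (-q) q = qPoch (-q) q (2 * r) * (1 + q ^ (2 * r + 1)) *
      (qPochInf (-q * q ^ (2 * r) * q) (q ^ 2) *
        qPochInf (-q * q ^ (2 * r) * q * q) (q ^ 2)) := by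
    rw [← qPochInf_eq_mul_sq _ hq, qPochInf_eq_mul (-q) hq (2 * r + 1), qPoch_succ, pow_succ,
      mul_assoc (-q)]
    ring
  have e2 : qPochInf (q ^ 2) (q ^ 2) = qPochInf q q * qPochInf (-q) q := qPochInf_sq q hq
  have n1 := qPochInf_self_ne_zero hq2
  have n2 : qPochInf q (q ^ 2) ≠ 0 := qPochInf_ne_zero_of_norm_lt hq2 hq
  have n3 := one_add_pow_ne_zero hq (2 * r).succ_ne_zero
  have e3 : 1 - (q ^ 2) ^ (2 * r + 1) = (1 - q ^ (2 * r + 1)) * (1 + q ^ (2 * r + 1)) := by ring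
  rw [e3, sptProdF3]
  rw [mul_div_assoc', mul_div_assoc', div_eq_iff (mul_ne_zero n1 n2), e2, e1]
  ring

theorem seriesTermF3_pos {z : ℂ} (hz : z ≠ 0) (q : ℂ) (r : ℕ) :
    seriesTermF3 z q (r + 1) = symFactor z r * ((-1) ^ r * q ^ (r ^ 2)) := by
  rw [seriesTermF3, symFactor_int_pos hz,
    show (r : ℤ) + 1 + 1 = ((r + 2 : ℕ) : ℤ) by push_cast; ring,
    show ((r : ℤ) + 1 - 1) ^ 2 = ((r ^ 2 : ℕ) : ℤ) by push_cast; ring, zpow_natCast, zpow_natCast]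
  ring

theorem seriesTermF3_neg {z : ℂ} (hz : z ≠ 0) (q : ℂ) (r : ℕ) :
    seriesTermF3 z q (-r) = symFactor z r * (-(-1) ^ r * q ^ ((r + 1) ^ 2)) := by
  have h : (-1 : ℂ) ^ (-(r : ℤ) + 1) = -(-1) ^ r := by
    rw [zpow_add₀ (by norm_num), zpow_neg, ← inv_zpow, inv_neg, inv_one, zpow_natCast, zpow_one]
    ring
  rw [seriesTermF3, symFactor_int_neg hz, h,
    show (-(r : ℤ) - 1) ^ 2 = (((r + 1) ^ 2 : ℕ) : ℤ) by push_cast; ring, zpow_natCast]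
  ring

theorem choose_two_le_sq (r : ℕ) : r.choose 2 ≤ r ^ 2 := by
  have := two_mul_choose_two_add r
  omega

theorem sq_pow_choose_two_mul (q : ℂ) (r : ℕ) : (q ^ 2) ^ (r.choose 2) * q ^ r = q ^ (r ^ 2) := by
  rw [← two_mul_choose_two_add r, pow_add, pow_mul]

theorem hasSum_seriesTermF3 {q z : ℂ} (hq : ‖q‖ < 1) (hz : z ≠ 0) :
    HasSum (fun j : ℤ => seriesTermF3 z q j)
      ((1 + z) * qPochInf q (q ^ 2) * (sptProdF3 q * ∑' n : ℕ, sptTermF3 z q (n + 1))) := by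
  obtain ⟨C, hC⟩ := exists_norm_weightF3_le hq
  have h := (hasSum_symSeries (norm_pow_lt_one hq two_ne_zero) hz (norm_nonneg q) hq hC).mul_left
    (qPochInf q (q ^ 2) * sptProdF3 q)
  simp only [← sptTermF3_eq hq] at h
  refine hasSum_int_of_symFactor hq (seriesTermF3_pos hz q) (seriesTermF3_neg hz q)
    (fun r => norm_mul_pow_le_of_le hq (by simp) (choose_two_le_sq r))
    (fun r => norm_mul_pow_le_of_le hq (by simp) ?_) (h.congr_both (fun r => ?_) (by ring))
  · exact (choose_two_le_sq r).trans (Nat.pow_le_pow_left r.le_succ 2)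
  -- With R = r + 1, the value q^R (1 - q^(2R+1)) times q^(R²-R) is q^(R²) - q^((R+1)²): the terms j
  -- = R + 1 and j = -R.
  · linear_combination (-symFactor z (r + 1) * ((-1) ^ (r + 1) * (q ^ 2) ^ ((r + 1).choose 2))) *
      conjSum_weightF3 hq (r + 1) - symFactor z (r + 1) * (-1) ^ (r + 1) *
      (1 - q ^ (2 * (r + 1) + 1)) * sq_pow_choose_two_mul q (r + 1)

/-! ### The functions `S_{G4}` and `S_{AG4}` -/

theorem sptProdG4_mul {q : ℂ} (hq : ‖q‖ < 1) :
    sptProdG4 q * qPochInf q (q ^ 2) = qPochInf (q ^ 2) (q ^ 2) := by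
  have hq2 := norm_pow_lt_one hq two_ne_zero
  have h1 := qPochInf_sq q hq2
  have h2 := qPochInf_eq_mul_sq (q ^ 2) hq2
  have e : (q ^ 2) ^ 2 = q ^ 4 := by ring
  rw [← pow_two, e] at h2
  rw [e] at h1
  rw [h2, h1, sptProdG4]
  ring

theorem qPoch_sq_two_mul_G4 (q : ℂ) (n : ℕ) :
    qPoch (q ^ 2) (q ^ 2) (2 * n) =
      qPoch q (q ^ 2) n * (qPoch (q ^ 4) (q ^ 4) n * qPoch (-q) (q ^ 2) n) := by
  rw [qPoch_two_mul, qPoch_sq, show q ^ 2 * q ^ 2 = q ^ 4 by ring,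
    show (q ^ 2) ^ 2 = q ^ 4 by ring]
  ring

/-- The weights of `S_{G4}` (`s = 2`) and `S_{AG4}` (`s = 0`). -/
noncomputable def weightG4 (q : ℂ) (s n : ℕ) : ℂ :=
  qPoch q (q ^ 2) n * ((-1) ^ n * q ^ (n ^ 2 + s * n))

theorem exists_norm_weightG4_le {q : ℂ} (hq : ‖q‖ < 1) (s : ℕ) :
    ∃ C : ℝ, ∀ n, ‖weightG4 q s (n + 1)‖ ≤ C * ‖q‖ ^ n := by
  obtain ⟨C, hC0, hC⟩ := exists_norm_qPoch_le q (norm_pow_lt_one hq two_ne_zero)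
  refine ⟨C, fun n => ?_⟩
  rw [weightG4, norm_mul]
  gcongr
  · exact hC _
  · exact norm_mul_pow_le_of_le hq (by simp) (by nlinarith)

theorem sptTermG4_eq {q : ℂ} (hq : ‖q‖ < 1) (z : ℂ) (n : ℕ) :
    sptTermG4 z q n = weightG4 q 2 n *
      (qPoch z (q ^ 2) n * qPoch z⁻¹ (q ^ 2) n / qPoch (q ^ 2) (q ^ 2) (2 * n)) := by
  have h : qPoch q (q ^ 2) n ≠ 0 :=
    qPoch_ne_zero_of_norm_lt (norm_pow_lt_one hq two_ne_zero) hq _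
  rw [sptTermG4, weightG4, qPoch_sq_two_mul_G4]
  field_simp

theorem sptTermAG4_eq {q : ℂ} (hq : ‖q‖ < 1) (z : ℂ) (n : ℕ) :
    sptTermAG4 z q n = weightG4 q 0 n *
      (qPoch z (q ^ 2) n * qPoch z⁻¹ (q ^ 2) n / qPoch (q ^ 2) (q ^ 2) (2 * n)) := by
  have h : qPoch q (q ^ 2) n ≠ 0 :=
    qPoch_ne_zero_of_norm_lt (norm_pow_lt_one hq two_ne_zero) hq _
  rw [sptTermAG4, weightG4, qPoch_sq_two_mul_G4, zero_mul, add_zero]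
  field_simp

/-- The Gauss parameters are a = q^(2r+1), x = 0, y = q^(2r+s+1), so ay = q^(4r+s+2): s = 2 balances
for the denominator index m + 2r + 1, s = 0 for m + 2r. -/
theorem weightG4_add (q : ℂ) (s r m : ℕ) :
    weightG4 q s (m + r) = weightG4 q s r *
      (qPoch (q * q ^ (2 * r)) (q ^ 2) m * qPochHom 0 (q ^ (2 * r + s + 1)) (q ^ 2) m) := by
  rw [qPochHom_zero_sq, weightG4, weightG4, add_comm m r, qPoch_add, ← pow_mul]
  ring

theorem conjSum_weightG4 {q : ℂ} (hq : ‖q‖ < 1) (r : ℕ) :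
    sptProdG4 q * ((1 - (q ^ 2) ^ (2 * r + 1)) * conjSum (q ^ 2) (weightG4 q 2) r) =
      (-1) ^ r * q ^ (r ^ 2 + 2 * r) * (1 + q ^ (2 * r + 1)) := by
  have hq2 := norm_pow_lt_one hq two_ne_zero
  have h := conjSum_eq (q := q ^ 2) (δ := weightG4 q 2) (r := r) hq2
    (by simp : ‖(0 : ℂ)‖ < 1) (weightG4_add q 2 r) (by ring)
  have e1 : qPochInf q (q ^ 2) = qPoch q (q ^ 2) r * (1 - q ^ (2 * r + 1)) *
      qPochInf (q ^ (2 * r + 2 + 1)) (q ^ 2) := by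
    rw [qPochInf_eq_mul q hq2 (r + 1), qPoch_succ,
      show q * (q ^ 2) ^ (r + 1) = q ^ (2 * r + 2 + 1) by ring,
      show q * (q ^ 2) ^ r = q ^ (2 * r + 1) by ring]
  have n1 := qPochInf_self_ne_zero hq2
  have e2 := sptProdG4_mul hq
  rw [h, mul_zero, qPochInf_zero, one_mul, mul_one, weightG4, mul_div_assoc', mul_div_assoc',
    div_eq_iff n1, ← e2, e1]
  ring

theorem hasSum_weightG4_zero {q : ℂ} (hq : ‖q‖ < 1) (r : ℕ) :
    HasSum (fun m => weightG4 q 0 (m + r) /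
        (qPoch (q ^ 2) (q ^ 2) m * qPoch (q ^ 2) (q ^ 2) (m + 2 * r)))
      ((-1) ^ r * q ^ (r ^ 2) / sptProdG4 q) := by
  have hq2 := norm_pow_lt_one hq two_ne_zero
  refine (hasSum_conj (q := q ^ 2) (δ := weightG4 q 0) (r := r) (s := 2 * r) hq2
    (by simp : ‖(0 : ℂ)‖ < 1) (weightG4_add q 0 r) (by ring)).congr_both (fun _ => rfl) ?_
  have e1 : qPochInf q (q ^ 2) = qPoch q (q ^ 2) r * qPochInf (q ^ (2 * r + 0 + 1)) (q ^ 2) := by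
    rw [qPochInf_eq_mul q hq2 r, show q * (q ^ 2) ^ r = q ^ (2 * r + 0 + 1) by ring]
  have n1 := qPochInf_self_ne_zero hq2
  have e2 := sptProdG4_mul hq
  rw [← e2] at n1
  rw [mul_zero, qPochInf_zero, one_mul, mul_one, weightG4, ← e2,
    div_eq_div_iff (left_ne_zero_of_mul n1) n1, e1]
  ring

theorem sptProdG4_ne_zero {q : ℂ} (hq : ‖q‖ < 1) : sptProdG4 q ≠ 0 :=
  left_ne_zero_of_mul
    ((sptProdG4_mul hq).symm ▸ qPochInf_self_ne_zero (norm_pow_lt_one hq two_ne_zero))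

theorem seriesTermG4_pos {z : ℂ} (hz : z ≠ 0) (q : ℂ) (r : ℕ) :
    seriesTermG4 z q (r + 1) = symFactor z r * q ^ (2 * r ^ 2 + 3 * r + 1) := by
  rw [seriesTermG4, symFactor_int_pos hz, show 2 * ((r : ℤ) + 1) ^ 2 - ((r : ℤ) + 1) =
    ((2 * r ^ 2 + 3 * r + 1 : ℕ) : ℤ) by push_cast; ring, zpow_natCast]

theorem seriesTermG4_neg {z : ℂ} (hz : z ≠ 0) (q : ℂ) (r : ℕ) :
    seriesTermG4 z q (-r) = symFactor z r * q ^ (2 * r ^ 2 + r) := by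
  rw [seriesTermG4, symFactor_int_neg hz, show 2 * (-(r : ℤ)) ^ 2 - -(r : ℤ) =
    ((2 * r ^ 2 + r : ℕ) : ℤ) by push_cast; ring, zpow_natCast]

theorem seriesTermAG4_pos {z : ℂ} (hz : z ≠ 0) (q : ℂ) (r : ℕ) :
    seriesTermAG4 z q (r + 1) = symFactor z r * q ^ (2 * r ^ 2 + 5 * r + 3) := by
  rw [seriesTermAG4, symFactor_int_pos hz, show 2 * ((r : ℤ) + 1) ^ 2 + ((r : ℤ) + 1) =
    ((2 * r ^ 2 + 5 * r + 3 : ℕ) : ℤ) by push_cast; ring, zpow_natCast]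

/-- The exponent 2r² - r is written with a binomial coefficient to avoid natural-number subtraction.
-/
theorem seriesTermAG4_neg {z : ℂ} (hz : z ≠ 0) (q : ℂ) (r : ℕ) :
    seriesTermAG4 z q (-r) = symFactor z r * q ^ (r ^ 2 + 2 * r.choose 2) := by
  have h : (2 * r.choose 2 + r : ℤ) = r ^ 2 := by exact_mod_cast two_mul_choose_two_add r
  rw [seriesTermAG4, symFactor_int_neg hz, show 2 * (-(r : ℤ)) ^ 2 + -(r : ℤ) =
    ((r ^ 2 + 2 * r.choose 2 : ℕ) : ℤ) by push_cast; linear_combination -h, zpow_natCast]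

theorem norm_pow_le_choose {q : ℂ} (hq : ‖q‖ < 1) {r e : ℕ} (h : r ^ 2 ≤ e) :
    ‖q ^ e‖ ≤ ‖q‖ ^ (r.choose 2) :=
  norm_pow_le_of_le hq ((choose_two_le_sq r).trans h)

theorem hasSum_seriesTermG4 {q z : ℂ} (hq : ‖q‖ < 1) (hz : z ≠ 0) :
    HasSum (fun j : ℤ => seriesTermG4 z q j)
      ((1 + z) * (sptProdG4 q * ∑' n : ℕ, sptTermG4 z q (n + 1))) := by
  obtain ⟨C, hC⟩ := exists_norm_weightG4_le hq 2
  have h := (hasSum_symSeries (norm_pow_lt_one hq two_ne_zero) hz (norm_nonneg q) hq hC).mul_left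
    (sptProdG4 q)
  simp only [← sptTermG4_eq hq] at h
  refine hasSum_int_of_symFactor hq (seriesTermG4_pos hz q) (seriesTermG4_neg hz q)
    (fun r => norm_pow_le_choose hq (by nlinarith)) (fun r => norm_pow_le_choose hq (by nlinarith))
    (h.congr_both (fun r => ?_) (by ring))
  have hs : ((-1 : ℂ) ^ (r + 1)) ^ 2 = 1 := by rw [← pow_mul, mul_comm, pow_mul]; simp
  linear_combination (-symFactor z (r + 1) * ((-1) ^ (r + 1) * (q ^ 2) ^ ((r + 1).choose 2))) *
    conjSum_weightG4 hq (r + 1) - symFactor z (r + 1) * ((-1) ^ (r + 1)) ^ 2 *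
    (q ^ ((r + 1) ^ 2 + (r + 1)) * (1 + q ^ (2 * (r + 1) + 1))) * sq_pow_choose_two_mul q (r + 1) -
    symFactor z (r + 1) * q ^ (2 * (r + 1) ^ 2 + (r + 1)) * (1 + q ^ (2 * (r + 1) + 1)) * hs

theorem hasSum_seriesTermAG4 {q z : ℂ} (hq : ‖q‖ < 1) (hz : z ≠ 0) :
    HasSum (fun j : ℤ => seriesTermAG4 z q j)
      ((1 + z) * (sptProdG4 q * ∑' n : ℕ, sptTermAG4 z q (n + 1))) := by
  obtain ⟨C, hC⟩ := exists_norm_weightG4_le hq 0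
  have hq2 := norm_pow_lt_one hq two_ne_zero
  have h := (hasSum_symSeries hq2 hz (norm_nonneg q) hq hC).mul_left (sptProdG4 q)
  simp only [← sptTermAG4_eq hq] at h
  refine hasSum_int_of_symFactor hq (seriesTermAG4_pos hz q) (seriesTermAG4_neg hz q)
    (fun r => norm_pow_le_choose hq (by nlinarith)) (fun r => norm_pow_le_choose hq (by omega))
    (h.congr_both (fun r => ?_) (by ring))
  have hs : ((-1 : ℂ) ^ (r + 1)) ^ 2 = 1 := by rw [← pow_mul, mul_comm, pow_mul]; simp
  have hP := sptProdG4_ne_zero hq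
  rw [one_sub_mul_conjSum hq2 (hasSum_weightG4_zero hq (r + 1))
    (hasSum_weightG4_zero hq (r + 1 + 1)), pow_succ (-1 : ℂ) (r + 1),
    show 2 * (r + 1) ^ 2 + 5 * (r + 1) + 3 =
      2 * (r + 1).choose 2 + ((r + 1) ^ 2 + 6 * (r + 1) + 3) by
      have := two_mul_choose_two_add (r + 1); linarith]
  field_simp
  generalize hu : (-1 : ℂ) ^ (r + 1) = u at *
  linear_combination (-symFactor z (r + 1) * q ^ (2 * (r + 1).choose 2) * (q ^ ((r + 1) ^ 2) +
    q ^ ((r + 1) ^ 2 + 6 * (r + 1) + 3))) * hs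

/-! ### The functions `S_{J1}`, `S_{J2}` and `S_{J3}` -/

/-- The weights of `S_{J2}` (`s = 1`) and `S_{J3}` (`s = 2`). -/
noncomputable def weightJ (q : ℂ) (s n : ℕ) : ℂ :=
  qPoch (q ^ 3) (q ^ 3) (n - 1) / qPoch q q (n - 1) * q ^ (s * n)

theorem exists_norm_weightJ_le {q : ℂ} (hq : ‖q‖ < 1) {s : ℕ} (hs : 1 ≤ s) :
    ∃ C : ℝ, ∀ n, ‖weightJ q s (n + 1)‖ ≤ C * ‖q‖ ^ n := by
  obtain ⟨C, hC0, hC⟩ := exists_norm_qPoch_le (q ^ 3) (norm_pow_lt_one hq three_ne_zero)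
  obtain ⟨D, hD0, hD⟩ := exists_norm_inv_qPoch_le hq (mul_pow_ne_one hq hq)
  refine ⟨C * D, fun n => ?_⟩
  rw [weightJ, div_eq_mul_inv, norm_mul, norm_mul]
  gcongr
  exacts [hC _, hD _, norm_pow_le_of_le hq (by nlinarith)]

theorem sptTermJ2_succ {q : ℂ} (hq : ‖q‖ < 1) (z : ℂ) (n : ℕ) :
    sptTermJ2 z q (n + 1) = weightJ q 1 (n + 1) *
      (qPoch z q (n + 1) * qPoch z⁻¹ q (n + 1) / qPoch q q (2 * (n + 1))) := by
  have h1 := qPoch_self_ne_zero hq n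
  have h2 := qPoch_self_ne_zero hq (2 * (n + 1))
  rw [sptTermJ2, weightJ, Nat.add_sub_cancel, one_mul]
  field_simp

theorem sptTermJ3_succ {q : ℂ} (hq : ‖q‖ < 1) (z : ℂ) (n : ℕ) :
    sptTermJ3 z q (n + 1) = weightJ q 2 (n + 1) *
      (qPoch z q (n + 1) * qPoch z⁻¹ q (n + 1) / qPoch q q (2 * (n + 1))) := by
  have h1 := qPoch_self_ne_zero hq n
  have h2 := qPoch_self_ne_zero hq (2 * (n + 1))
  rw [sptTermJ3, weightJ, Nat.add_sub_cancel]
  field_simp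

/-- With N = n + 1, it comes down to (1 - q^(2N)) / (1 - q^N) = 1 + q^N. -/
theorem sptTermJ1_succ {q : ℂ} (hq : ‖q‖ < 1) (z : ℂ) (n : ℕ) :
    sptTermJ1 z q (n + 1) = sptTermJ2 z q (n + 1) + sptTermJ3 z q (n + 1) := by
  have h1 := qPoch_self_ne_zero hq n
  have h2 := qPoch_self_ne_zero hq (2 * n + 1)
  have h3 := one_sub_pow_ne_zero hq (2 * n + 1).succ_ne_zero
  have h4 := one_sub_pow_ne_zero hq n.succ_ne_zero
  rw [Nat.succ_eq_add_one] at h3 h4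
  rw [sptTermJ1, sptTermJ2, sptTermJ3, Nat.add_sub_cancel, show 2 * (n + 1) = 2 * n + 1 + 1 by ring,
    Nat.add_sub_cancel, qPoch_succ q q n, qPoch_succ q q (2 * n + 1), ← pow_succ', ← pow_succ']
  generalize qPoch z q (n + 1) = A
  generalize qPoch z⁻¹ q (n + 1) = B
  field_simp
  ring

/-- Dividing (q³; q³) by (q; q) leaves the two factors with w and w². Since w³ = 1, ay =
q^(2(r+1)+s): s = 1 balances for the denominator index m + 2(r+1), s = 2 for m + 2(r+1) + 1. The
index starts at r + 1 because the weight involves n - 1. -/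
theorem weightJ_add {q w : ℂ} (hq : ‖q‖ < 1) (hw : w ^ 2 + w + 1 = 0) (s r m : ℕ) :
    weightJ q s (m + (r + 1)) = weightJ q s (r + 1) * (qPoch (w * q ^ (r + 1)) q m *
      qPochHom (q ^ s) (w ^ 2 * q ^ (r + 1) * q ^ s) q m) := by
  have h1 := qPoch_self_ne_zero hq r
  have h2 : qPoch (q ^ (r + 1)) q m ≠ 0 :=
    qPoch_ne_zero_of_norm_lt hq (norm_pow_lt_one hq r.succ_ne_zero) m
  rw [qPochHom_self_mul, weightJ, weightJ, show m + (r + 1) - 1 = r + m by omega,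
    Nat.add_sub_cancel, qPoch_add, qPoch_add, ← pow_succ' q,
    show q ^ 3 * (q ^ 3) ^ r = (q ^ (r + 1)) ^ 3 by ring, qPoch_cube hw (q ^ (r + 1)),
    show s * (m + (r + 1)) = s * m + s * (r + 1) by ring, pow_add q (s * m), pow_mul q s m]
  field_simp

theorem sptProdJ_ne_zero {q : ℂ} (hq : ‖q‖ < 1) : sptProdJ q ≠ 0 :=
  div_ne_zero (pow_ne_zero 2 (qPochInf_self_ne_zero hq))
    (qPochInf_self_ne_zero (norm_pow_lt_one hq three_ne_zero))

theorem qPochInf_cube_tail {q w : ℂ} (hq : ‖q‖ < 1) (hw : w ^ 2 + w + 1 = 0) (n : ℕ) :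
    qPochInf (w * q ^ (n + 1)) q * qPochInf (w ^ 2 * q ^ (n + 1)) q =
      qPochInf (q ^ 3) (q ^ 3) * qPoch q q n / (qPochInf q q * qPoch (q ^ 3) (q ^ 3) n) := by
  have hq3 := norm_pow_lt_one hq three_ne_zero
  have h1 := qPochInf_eq_mul q hq n
  have h2 := qPochInf_eq_mul (q ^ 3) hq3 n
  rw [← pow_succ'] at h1
  rw [show q ^ 3 * (q ^ 3) ^ n = (q ^ (n + 1)) ^ 3 by ring, qPochInf_cube hw (q ^ (n + 1)) hq] at h2
  have n1 := qPochInf_self_ne_zero hq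
  have n2 := qPoch_self_ne_zero hq3 n
  rw [eq_div_iff (mul_ne_zero n1 n2), h2, h1]
  ring

theorem one_sub_pow_three_ne_zero {q : ℂ} (hq : ‖q‖ < 1) (n : ℕ) : 1 - (q ^ (n + 1)) ^ 3 ≠ 0 := by
  rw [← pow_mul]; exact one_sub_pow_ne_zero hq (by omega)

theorem hasSum_weightJ_one {q : ℂ} (hq : ‖q‖ < 1) (r : ℕ) :
    HasSum (fun m => weightJ q 1 (m + (r + 1)) / (qPoch q q m * qPoch q q (m + 2 * (r + 1))))
      (q ^ (r + 1) * (1 - q ^ (r + 1)) / (1 - (q ^ (r + 1)) ^ 3) /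
        (sptProdJ q * qPochInf q q)) := by
  obtain ⟨w, hw⟩ := exists_cube_root
  have hw3 : w ^ 3 = 1 := by linear_combination (w - 1) * hw
  have hq3 := norm_pow_lt_one hq three_ne_zero
  refine (hasSum_conj (δ := weightJ q 1) (r := r + 1) (s := 2 * (r + 1)) hq
    (by rwa [pow_one]) (weightJ_add hq hw 1 r)
    (by linear_combination q ^ (2 * r + 3) * hw3)).congr_both (fun _ => rfl) ?_
  have n1 := qPochInf_self_ne_zero hq
  have n2 := qPochInf_self_ne_zero hq3
  have n3 := qPoch_self_ne_zero hq3 r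
  have n4 := qPoch_self_ne_zero hq r
  have n5 := one_sub_pow_three_ne_zero hq r
  have e := qPochInf_cube_tail hq hw (r + 1)
  rw [qPoch_succ, qPoch_succ, ← pow_succ', ← pow_succ', pow_right_comm] at e
  rw [pow_one, mul_assoc, mul_assoc, ← pow_succ, e, weightJ, Nat.add_sub_cancel, sptProdJ, one_mul]
  field_simp

theorem conjSum_weightJ_two {q : ℂ} (hq : ‖q‖ < 1) (r : ℕ) :
    conjSum q (weightJ q 2) (r + 1) =
      q ^ (2 * (r + 1)) * (1 - q) * (1 - q ^ (r + 1)) * (1 - q ^ (r + 2)) /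
        ((1 - (q ^ (r + 1)) ^ 3) * (1 - (q ^ (r + 2)) ^ 3)) / (sptProdJ q * qPochInf q q) := by
  obtain ⟨w, hw⟩ := exists_cube_root
  have hw3 : w ^ 3 = 1 := by linear_combination (w - 1) * hw
  have hq3 := norm_pow_lt_one hq three_ne_zero
  rw [conjSum_eq (δ := weightJ q 2) (r := r + 1) hq (norm_pow_lt_one hq two_ne_zero)
    (weightJ_add hq hw 2 r) (by linear_combination q ^ (2 * r + 4) * hw3)]
  have n1 := qPochInf_self_ne_zero hq
  have n2 := qPochInf_self_ne_zero hq3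
  have n3 := qPoch_self_ne_zero hq3 r
  have n4 := qPoch_self_ne_zero hq r
  have n5 := one_sub_pow_three_ne_zero hq r
  have n6 := one_sub_pow_three_ne_zero hq (r + 1)
  have n7 := one_sub_pow_ne_zero hq one_ne_zero
  have e := qPochInf_cube_tail hq hw (r + 2)
  -- The argument x = q² contributes 1/(q²; q)_∞ = (1 - q)/(q; q)_∞, the source of the factor 1 - q.
  have e1 := qPochInf_eq_mul q hq 1
  rw [qPoch_succ, qPoch_zero, pow_zero, mul_one, one_mul, pow_one, ← pow_two] at e1
  have n8 := right_ne_zero_of_mul (e1 ▸ n1)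
  rw [pow_one] at n7
  rw [qPoch_succ, qPoch_succ, qPoch_succ, qPoch_succ, ← pow_succ', ← pow_succ', ← pow_succ',
    ← pow_succ', pow_right_comm q 3, pow_right_comm q 3] at e
  rw [mul_assoc, mul_assoc, ← pow_add, show r + 1 + 2 = r + 2 + 1 by ring, e, weightJ,
    Nat.add_sub_cancel, sptProdJ]
  rw [show (r + 1 + 1) = r + 2 from rfl] at *
  field_simp
  rw [e1]
  ring

theorem seriesTerm_prefix {z : ℂ} (hz : z ≠ 0) (q : ℂ) (r : ℕ) :
    (1 - z ^ (r + 2 - 1)) * (1 - z ^ (r + 2)) * z ^ (1 - ((r + 2 : ℕ) : ℤ)) * (-1) ^ (r + 2 + 1) *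
        q ^ ((r + 2) * (r + 2 - 1) / 2) =
      symFactor z (r + 1) * ((-1) ^ (r + 1) * q ^ ((r + 1).choose 2) * q ^ (r + 1)) := by
  rw [← symFactor_nat hz, ← Nat.choose_two_right, choose_two_succ,
    show (1 : ℤ) - ((r + 2 : ℕ) : ℤ) = -((r + 1 : ℕ) : ℤ) by push_cast; ring, zpow_neg,
    zpow_natCast, inv_pow, show r + 2 - 1 = r + 1 by omega]
  ring

theorem seriesTermJ1_add_two (z q : ℂ) (r : ℕ) :
    seriesTermJ1 z q (r + 2) = seriesTermJ2 z q (r + 2) + seriesTermJ3 z q (r + 2) := by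
  rw [seriesTermJ1, seriesTermJ2, seriesTermJ3]
  ring

theorem hasSum_seriesTermJ2 {q z : ℂ} (hq : ‖q‖ < 1) (hz : z ≠ 0) :
    HasSum (fun j : ℕ => seriesTermJ2 z q (j + 2))
      ((1 + z) * qPochInf q q * (sptProdJ q * ∑' n : ℕ, sptTermJ2 z q (n + 1))) := by
  obtain ⟨C, hC⟩ := exists_norm_weightJ_le hq le_rfl
  have h := (hasSum_symSeries hq hz (norm_nonneg q) hq hC).mul_left (sptProdJ q * qPochInf q q)
  simp only [← sptTermJ2_succ hq] at h
  refine h.congr_both (fun r => ?_) (by ring)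
  have n1 := one_sub_pow_three_ne_zero hq r
  have n2 := one_sub_pow_three_ne_zero hq (r + 1)
  have n3 := sptProdJ_ne_zero hq
  have n4 := qPochInf_self_ne_zero hq
  -- With j = r + 2, the six-term numerator is (1 - q^(j-1))(1 - q^(3j)) - q^(2j) (1 - q^j)(1 -
  -- q^(3j-3)), one product from each of the two sums.
  rw [one_sub_mul_conjSum hq (hasSum_weightJ_one hq r) (hasSum_weightJ_one hq (r + 1)),
    seriesTermJ2, seriesTerm_prefix hz,
    show r + 2 - 1 = r + 1 by omega, show 4 * (r + 2) - 1 = 4 * r + 7 by omega,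
    show 5 * (r + 2) - 3 = 5 * r + 7 by omega, show 6 * (r + 2) - 3 = 6 * r + 9 by omega,
    show 3 * (r + 2) - 3 = 3 * (r + 1) by omega, show q ^ (3 * (r + 1)) = (q ^ (r + 1)) ^ 3 by ring,
    show q ^ (3 * (r + 2)) = (q ^ (r + 1 + 1)) ^ 3 by ring]
  field_simp
  ring

theorem hasSum_seriesTermJ3 {q z : ℂ} (hq : ‖q‖ < 1) (hz : z ≠ 0) :
    HasSum (fun j : ℕ => seriesTermJ3 z q (j + 2))
      ((1 + z) * qPochInf q q * (sptProdJ q * ∑' n : ℕ, sptTermJ3 z q (n + 1))) := by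
  obtain ⟨C, hC⟩ := exists_norm_weightJ_le hq one_le_two
  have h := (hasSum_symSeries hq hz (norm_nonneg q) hq hC).mul_left (sptProdJ q * qPochInf q q)
  simp only [← sptTermJ3_succ hq] at h
  refine h.congr_both (fun r => ?_) (by ring)
  have n1 := one_sub_pow_three_ne_zero hq r
  have n2 := one_sub_pow_three_ne_zero hq (r + 1)
  have n3 := sptProdJ_ne_zero hq
  have n4 := qPochInf_self_ne_zero hq
  -- With j = r + 2, the eight-term numerator factors as q^(j-1) (1 - q)(1 - q^(j-1))(1 - q^j)(1 -
  -- q^(2j-1)).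
  rw [conjSum_weightJ_two hq, seriesTermJ3, seriesTerm_prefix hz,
    show r + 2 - 1 = r + 1 by omega, show 4 * (r + 2) - 1 = 4 * r + 7 by omega,
    show 4 * (r + 2) - 3 = 4 * r + 5 by omega, show 2 * (r + 2) - 2 = 2 * r + 2 by omega,
    show 5 * (r + 2) - 3 = 5 * r + 7 by omega, show 5 * (r + 2) - 2 = 5 * r + 8 by omega,
    show 3 * (r + 2) - 3 = 3 * (r + 1) by omega, show q ^ (3 * (r + 1)) = (q ^ (r + 1)) ^ 3 by ring,
    show q ^ (3 * (r + 2)) = (q ^ (r + 1 + 1)) ^ 3 by ring]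
  field_simp
  ring

/-! ### Convergence of the six defining series, and the identity for J1 -/

theorem summable_sptTermJ2 {q : ℂ} (hq : ‖q‖ < 1) (z : ℂ) :
    Summable (fun n : ℕ => sptTermJ2 z q (n + 1)) := by
  obtain ⟨C, hC⟩ := exists_norm_weightJ_le hq le_rfl
  simpa only [← sptTermJ2_succ hq] using summable_symSeries (z := z) hq (norm_nonneg q) hq hC

theorem summable_sptTermJ3 {q : ℂ} (hq : ‖q‖ < 1) (z : ℂ) :
    Summable (fun n : ℕ => sptTermJ3 z q (n + 1)) := by
  obtain ⟨C, hC⟩ := exists_norm_weightJ_le hq one_le_two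
  simpa only [← sptTermJ3_succ hq] using summable_symSeries (z := z) hq (norm_nonneg q) hq hC

theorem summable_sptTermJ1 {q : ℂ} (hq : ‖q‖ < 1) (z : ℂ) :
    Summable (fun n : ℕ => sptTermJ1 z q (n + 1)) := by
  simpa only [sptTermJ1_succ hq] using (summable_sptTermJ2 hq z).add (summable_sptTermJ3 hq z)

theorem summable_sptTermF3 {q : ℂ} (hq : ‖q‖ < 1) (z : ℂ) :
    Summable (fun n : ℕ => sptTermF3 z q (n + 1)) := by
  obtain ⟨C, hC⟩ := exists_norm_weightF3_le hq
  simpa only [← sptTermF3_eq hq] using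
    summable_symSeries (z := z) (norm_pow_lt_one hq two_ne_zero) (norm_nonneg q) hq hC

theorem summable_sptTermG4 {q : ℂ} (hq : ‖q‖ < 1) (z : ℂ) :
    Summable (fun n : ℕ => sptTermG4 z q (n + 1)) := by
  obtain ⟨C, hC⟩ := exists_norm_weightG4_le hq 2
  simpa only [← sptTermG4_eq hq] using
    summable_symSeries (z := z) (norm_pow_lt_one hq two_ne_zero) (norm_nonneg q) hq hC

theorem summable_sptTermAG4 {q : ℂ} (hq : ‖q‖ < 1) (z : ℂ) :
    Summable (fun n : ℕ => sptTermAG4 z q (n + 1)) := by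
  obtain ⟨C, hC⟩ := exists_norm_weightG4_le hq 0
  simpa only [← sptTermAG4_eq hq] using
    summable_symSeries (z := z) (norm_pow_lt_one hq two_ne_zero) (norm_nonneg q) hq hC

theorem hasSum_seriesTermJ1 {q z : ℂ} (hq : ‖q‖ < 1) (hz : z ≠ 0) :
    HasSum (fun j : ℕ => seriesTermJ1 z q (j + 2))
      ((1 + z) * qPochInf q q * (sptProdJ q * ∑' n : ℕ, sptTermJ1 z q (n + 1))) := by
  simp only [sptTermJ1_succ hq]
  rw [(summable_sptTermJ2 hq z).tsum_add (summable_sptTermJ3 hq z)]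
  exact ((hasSum_seriesTermJ2 hq hz).add (hasSum_seriesTermJ3 hq hz)).congr_both
    (seriesTermJ1_add_two z q) (by ring)

/-! ### Restoring the factor (z, z⁻¹; ·)_∞, and the final statement -/

theorem qPochInf_mul_inv_ne_zero {q z : ℂ} (hq : ‖q‖ < 1) (h : ∀ k : ℤ, z ≠ q ^ k) :
    qPochInf z q * qPochInf z⁻¹ q ≠ 0 := by
  refine mul_ne_zero (qPochInf_ne_zero hq fun k hk => ?_) (qPochInf_ne_zero hq fun k hk => ?_)
  -- A vanishing factor of (z; q)_∞ forces z = q^(-k), one of (z⁻¹; q)_∞ forces z = q^k; both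
  -- exponents are excluded.
  · exact h (-k) (by rw [zpow_neg, zpow_natCast]; exact eq_inv_of_mul_eq_one_left hk)
  · exact h k (by
      rw [zpow_natCast, ← inv_inv z]; exact inv_eq_of_mul_eq_one_right hk)

theorem theorem2p2 (q z : ℂ) (hq : ‖q‖ < 1) (hz : z ≠ 0) :
    -- the series defining the functions `S_X` converge
    (Summable (fun n : ℕ => sptTermJ1 z q (n + 1)) ∧
      Summable (fun n : ℕ => sptTermJ2 z q (n + 1)) ∧
      Summable (fun n : ℕ => sptTermJ3 z q (n + 1)) ∧
      Summable (fun n : ℕ => sptTermF3 z q (n + 1)) ∧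
      Summable (fun n : ℕ => sptTermG4 z q (n + 1)) ∧
      Summable (fun n : ℕ => sptTermAG4 z q (n + 1))) ∧
    -- the identities for `J1`, `J2`, `J3`, wherever `(z, z⁻¹; q)_∞` does not vanish
    ((∀ k : ℤ, z ≠ q ^ k) →
      HasSum (fun j : ℕ => seriesTermJ1 z q (j + 2))
        ((1 + z) * (qPochInf z q * qPochInf z⁻¹ q * qPochInf q q) * sptJ1 z q) ∧
      HasSum (fun j : ℕ => seriesTermJ2 z q (j + 2))
        ((1 + z) * (qPochInf z q * qPochInf z⁻¹ q * qPochInf q q) * sptJ2 z q) ∧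
      HasSum (fun j : ℕ => seriesTermJ3 z q (j + 2))
        ((1 + z) * (qPochInf z q * qPochInf z⁻¹ q * qPochInf q q) * sptJ3 z q)) ∧
    -- the identities for `F3`, `G4`, `AG4`, wherever `(z, z⁻¹; q²)_∞` does not vanish
    ((∀ k : ℤ, z ≠ (q ^ 2) ^ k) →
      HasSum (fun j : ℤ => seriesTermF3 z q j)
        ((1 + z) * (qPochInf z (q ^ 2) * qPochInf z⁻¹ (q ^ 2) * qPochInf q (q ^ 2)) *
          sptF3 z q) ∧
      HasSum (fun j : ℤ => seriesTermG4 z q j)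
        ((1 + z) * (qPochInf z (q ^ 2) * qPochInf z⁻¹ (q ^ 2)) * sptG4 z q) ∧
      HasSum (fun j : ℤ => seriesTermAG4 z q j)
        ((1 + z) * (qPochInf z (q ^ 2) * qPochInf z⁻¹ (q ^ 2)) * sptAG4 z q)) ∧
    -- all six identities for every `z ≠ 0`, the factor `(z, z⁻¹; ·)_∞` being cancelled against
    -- the denominator of `S_X`
    (HasSum (fun j : ℕ => seriesTermJ1 z q (j + 2))
        ((1 + z) * qPochInf q q * (sptProdJ q * ∑' n : ℕ, sptTermJ1 z q (n + 1))) ∧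
      HasSum (fun j : ℕ => seriesTermJ2 z q (j + 2))
        ((1 + z) * qPochInf q q * (sptProdJ q * ∑' n : ℕ, sptTermJ2 z q (n + 1))) ∧
      HasSum (fun j : ℕ => seriesTermJ3 z q (j + 2))
        ((1 + z) * qPochInf q q * (sptProdJ q * ∑' n : ℕ, sptTermJ3 z q (n + 1))) ∧
      HasSum (fun j : ℤ => seriesTermF3 z q j)
        ((1 + z) * qPochInf q (q ^ 2) * (sptProdF3 q * ∑' n : ℕ, sptTermF3 z q (n + 1))) ∧
      HasSum (fun j : ℤ => seriesTermG4 z q j)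
        ((1 + z) * (sptProdG4 q * ∑' n : ℕ, sptTermG4 z q (n + 1))) ∧
      HasSum (fun j : ℤ => seriesTermAG4 z q j)
        ((1 + z) * (sptProdG4 q * ∑' n : ℕ, sptTermAG4 z q (n + 1)))) := by

  refine ⟨⟨summable_sptTermJ1 hq z, summable_sptTermJ2 hq z, summable_sptTermJ3 hq z,
    summable_sptTermF3 hq z, summable_sptTermG4 hq z, summable_sptTermAG4 hq z⟩,
    fun h => ?_, fun h => ?_, hasSum_seriesTermJ1 hq hz, hasSum_seriesTermJ2 hq hz,
    hasSum_seriesTermJ3 hq hz, hasSum_seriesTermF3 hq hz, hasSum_seriesTermG4 hq hz,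
    hasSum_seriesTermAG4 hq hz⟩
  · have hne := qPochInf_mul_inv_ne_zero hq h
    refine ⟨(hasSum_seriesTermJ1 hq hz).congr_both (fun _ => rfl) ?_,
      (hasSum_seriesTermJ2 hq hz).congr_both (fun _ => rfl) ?_,
      (hasSum_seriesTermJ3 hq hz).congr_both (fun _ => rfl) ?_⟩
    · rw [sptJ1]; generalize qPochInf z q * qPochInf z⁻¹ q = A at *; field_simp
    · rw [sptJ2]; generalize qPochInf z q * qPochInf z⁻¹ q = A at *; field_simp
    · rw [sptJ3]; generalize qPochInf z q * qPochInf z⁻¹ q = A at *; field_simp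
  · have hne := qPochInf_mul_inv_ne_zero (norm_pow_lt_one hq two_ne_zero) h
    refine ⟨(hasSum_seriesTermF3 hq hz).congr_both (fun _ => rfl) ?_,
      (hasSum_seriesTermG4 hq hz).congr_both (fun _ => rfl) ?_,
      (hasSum_seriesTermAG4 hq hz).congr_both (fun _ => rfl) ?_⟩
    · rw [sptF3]; generalize qPochInf z (q ^ 2) * qPochInf z⁻¹ (q ^ 2) = A at *; field_simp
    · rw [sptG4]; generalize qPochInf z (q ^ 2) * qPochInf z⁻¹ (q ^ 2) = A at *; field_simp
    · rw [sptAG4]; generalize qPochInf z (q ^ 2) * qPochInf z⁻¹ (q ^ 2) = A at *; field_simp
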